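/- Let $\mathcal{D} \subset \mathcal{M}$ be von Neumann algebras on a Hilbert space $H$, with the same unit. Let $\omega$ be a normal (that is, weak* continuous) state on $\mathcal{M}$ such that $\omega(ax) = \omega(xa)$ for all $a \in \mathcal{D}$ and $x \in \mathcal{M}$. Let $z \in \mathcal{D}$ be the support projection of $\omega_{|\mathcal{D}}$, that is, $1-z$ is the largest projection $p \in \mathcal{D}$ with $\omega(p) = 0$. For a normal positive map $E : \mathcal{M} \to \mathcal{M}$ let $\operatorname{supp}(E)$ denote the projection $s \in \mathcal{M}$ such that $1-s$ is the largest projection $p \in \mathcal{M}$ with $E(p) = 0$. Then there exists a unique $\omega$-preserving (i.e. $\omega \circ E = \omega$) normal (i.e. weak* continuous) idempotent contractive $\mathcal{D}$-module map $E$ (linear, with $E(dx) = dE(x)$ and $E(xd) = E(x)d$ for $d \in \mathcal{D}$, $x \in \mathcal{M}$) from $\mathcal{M}$ onto a (not necessarily unital) $*$-subalgebra of $\mathcal{D}$ with $\operatorname{supp}(E) \leq z$. (A normal contractive idempotent map onto a $*$-subalgebra is automatically positive, so that $\operatorname{supp}(E)$ makes sense.) Moreover this map $E$ is completely positive, and its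 range is $E(\mathcal{M}) = z\mathcal{D}$, which is a two-sided ideal in $\mathcal{D}$. -/

import Mathlib

open scoped ComplexOrder CStarAlgebra Topology

namespace VonNeumannAlgebra

variable {H : Type*} [NormedAddCommGroup H] [InnerProductSpace ℂ H] [CompleteSpace H]

/-! A von Neumann algebra `M` on `H` is a C⋆-algebra, with the norm and the (Loewner) order
that it inherits from the bounded operators on `H`. -/

instance instSMulMemClassComplex : SMulMemClass (VonNeumannAlgebra H) ℂ (H →L[ℂ] H) where
  smul_mem {s} r _ hx := s.toStarSubalgebra.smul_mem hx r

instance instIsClosedCoe (M : VonNeumannAlgebra H) : IsClosed (M : Set (H →L[ℂ] H)) := by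
  rw [← M.centralizer_centralizer]
  exact Set.isClosed_centralizer _

theorem sqrt_mem (M : VonNeumannAlgebra H) {x : H →L[ℂ] H} (hx : x ∈ M) :
    CFC.sqrt x ∈ M := by
  rw [← M.commutant_commutant, mem_commutant_iff]
  intro g hg
  have hc : Commute x g := (mem_commutant_iff.1 hg) x hx
  exact (hc.cfcₙ_nnreal _).eq.symm

instance instStarOrderedRing (M : VonNeumannAlgebra H) : StarOrderedRing M :=
  StarOrderedRing.of_nonneg_iff' (fun {x y} h z => by
      have h' : (x : H →L[ℂ] H) ≤ y := h
      change (z : H →L[ℂ] H) + x ≤ z + y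
      gcongr) (fun x => by
    constructor
    · intro h
      have h' : (0 : H →L[ℂ] H) ≤ x := h
      refine ⟨⟨CFC.sqrt (x : H →L[ℂ] H), M.sqrt_mem x.2⟩, Subtype.ext ?_⟩
      have hs : star (CFC.sqrt (x : H →L[ℂ] H)) = CFC.sqrt (x : H →L[ℂ] H) :=
        (IsSelfAdjoint.of_nonneg (CFC.sqrt_nonneg _)).star_eq
      change (x : H →L[ℂ] H) = star (CFC.sqrt (x : H →L[ℂ] H)) * CFC.sqrt (x : H →L[ℂ] H)
      rw [hs, CFC.sqrt_mul_sqrt_self _ h']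
    · rintro ⟨s, rfl⟩
      change (0 : H →L[ℂ] H) ≤ star (s : H →L[ℂ] H) * s
      exact star_mul_self_nonneg _)

/-- The ultraweak (σ-weak, weak*) topology of `M`: the coarsest topology for which all the
functionals `x ↦ ∑ₙ ⟨x ξₙ, ηₙ⟩` with `∑ ‖ξₙ‖² < ∞` and `∑ ‖ηₙ‖² < ∞` are continuous. -/
noncomputable abbrev ultraweak (M : VonNeumannAlgebra H) : TopologicalSpace M :=
  ⨅ p : lp (fun _ : ℕ => H) 2 × lp (fun _ : ℕ => H) 2,
    TopologicalSpace.induced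
      (fun x : M => ∑' n, inner ℂ (p.2 n) ((x : H →L[ℂ] H) (p.1 n))) inferInstance

/-- A normal state of `M`: a positive, unital, weak* continuous linear functional. -/
structure IsNormalState (M : VonNeumannAlgebra H) (ω : M →ₗ[ℂ] ℂ) : Prop where
  nonneg : ∀ x : M, 0 ≤ x → 0 ≤ ω x
  map_one : ω 1 = 1
  normal : Continuous[M.ultraweak, inferInstance] ω

/-- For a map `f` on `M` and a von Neumann subalgebra `N` of `M`, `z` is the support projection
of the restriction of `f` to `N`: the complement `1 - z` is the largest among the projections
`p` of `N` with `f p = 0`. -/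
def IsSupportProjection {M : VonNeumannAlgebra H} (N : VonNeumannAlgebra H)
    {V : Type*} [Zero V] (f : M → V) (z : M) : Prop :=
  IsGreatest {p : M | (p : H →L[ℂ] H) ∈ N ∧ IsStarProjection p ∧ f p = 0} (1 - z)

/-- `E` is an `ω`-preserving normal idempotent contractive `D`-module map from `M` onto
a `*`-subalgebra of `D`, whose support projection (in `M`) is at most `z`. -/
structure IsPreservingModuleProjection {M : VonNeumannAlgebra H} (D : VonNeumannAlgebra H)
    (ω : M →ₗ[ℂ] ℂ) (z : M) (E : M →ₗ[ℂ] M) : Prop where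
  preserving : ∀ x : M, ω (E x) = ω x
  normal : Continuous[M.ultraweak, M.ultraweak] E
  idempotent : ∀ x : M, E (E x) = E x
  contractive : ∀ x : M, ‖E x‖ ≤ ‖x‖
  map_left : ∀ d : M, (d : H →L[ℂ] H) ∈ D → ∀ x : M, E (d * x) = d * E x
  map_right : ∀ d : M, (d : H →L[ℂ] H) ∈ D → ∀ x : M, E (x * d) = E x * d
  range_starSubalgebra : ∃ R : NonUnitalStarSubalgebra ℂ M,
    (∀ r ∈ R, (r : H →L[ℂ] H) ∈ D) ∧ Set.range E = R
  support_le : ∃ s : M, IsSupportProjection M E s ∧ s ≤ z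

end VonNeumannAlgebra

/-! A normal state is a vector state `ω x = ⟪ξ, x ξ⟫` once `H` is replaced by its countable
amplification, on which operators act diagonally (`IsNormalState.exists_vector`). The support
projection `z` of `ω` on `D` projects onto the closure of all `c ξ`, where `c` runs over the bounded
`D`-intertwiners from the amplification to `H`. Since `ω` is tracial on `D`, `‖d* ξ‖ = ‖d ξ‖`; hence
the left kernel of `ω` on `D` is self-adjoint and `z` is central in `D`.

The map is the conditional expectation onto `zD`: `E x` is the only `y ∈ D` with `y z = y` and `ω (d
y) = ω (d x)` for all `d ∈ D`. For existence, let `P` project onto the closure of `D ξ`. The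
centralizing hypothesis makes `P x P`, for `x ∈ M`, commute with `P C P` for every `C` commuting
with `D` (`IsCentralizing.commute_compression`). This commutation bounds the assignment `c ξ ↦ c (P
x ξ)` by `‖x‖`, and its extension by zero lies in `D'' = D` and is the required `y`
(`IsCentralizing.exists_expectation`). Linearity, the module property and idempotence then follow
from uniqueness of `y`.

Normality rests on a Radon–Nikodym argument: on `D`, a vector state supported under `z`, after
adding `ω`, is the vector state of some `ζ` in the closure of `D ξ`
(`IsCentralizing.exists_mem_cyclicSpace`), and for such vectors `⟪ζ, E x ζ⟫ = ⟪ζ, x ζ⟫`. Complete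
positivity comes from testing the negative part of the matrix of values against `ω`. Finally, any
competing map has the two properties that characterize `E x`, so it equals `E`. -/

open scoped InnerProductSpace

/-! ### Factorization, absolute values and commutation on Hilbert spaces -/

section Hilbert

variable {E G₁ G₂ : Type*} [AddCommGroup E] [Module ℂ E]
  [NormedAddCommGroup G₁] [InnerProductSpace ℂ G₁] [CompleteSpace G₁]
  [NormedAddCommGroup G₂] [InnerProductSpace ℂ G₂]

/-- A linear map dominated by `f` factors through `f` by an operator vanishing on the orthogonal
complement of the range of `f`. -/
theorem LinearMap.exists_clm_of_norm_le [CompleteSpace G₂] (f : E →ₗ[ℂ] G₁) (g : E →ₗ[ℂ] G₂)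
    {C : ℝ} (hC : 0 ≤ C) (h : ∀ e, ‖g e‖ ≤ C * ‖f e‖) :
    ∃ W : G₁ →L[ℂ] G₂, (∀ e, W (f e) = g e) ∧ (∀ v ∈ (LinearMap.range f)ᗮ, W v = 0) ∧
      ‖W‖ ≤ C := by
  set U := (LinearMap.range f).topologicalClosure with hU
  have hmem : ∀ e, f e ∈ U := fun e => Submodule.le_topologicalClosure _ ⟨e, rfl⟩
  let f' : E →ₗ[ℂ] U := f.codRestrict U hmem
  have hd : DenseRange f' := by
    rw [DenseRange, Subtype.dense_iff]
    intro x hx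
    have hx' : x ∈ closure (LinearMap.range f : Set G₁) := hx
    refine closure_mono ?_ hx'
    rintro _ ⟨e, rfl⟩
    exact ⟨f' e, ⟨e, rfl⟩, rfl⟩
  have hn : ∀ e, ‖g e‖ ≤ C * ‖f' e‖ := h
  refine ⟨(g.extendOfNorm f') ∘L U.orthogonalProjectionOnto, fun e => ?_, fun v hv => ?_, ?_⟩
  · have : U.orthogonalProjectionOnto (f e) = f' e :=
      Submodule.orthogonalProjectionOnto_mem_subspace_eq_self (f' e)
    rw [ContinuousLinearMap.comp_apply, this]
    exact LinearMap.extendOfNorm_eq hd ⟨C, hn⟩ e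
  · rw [← Submodule.orthogonal_closure] at hv
    rw [ContinuousLinearMap.comp_apply,
      Submodule.orthogonalProjectionOnto_eq_zero_iff.2 hv, map_zero]
  · refine ContinuousLinearMap.opNorm_le_bound _ hC fun v => ?_
    refine (LinearMap.norm_extendOfNorm_apply_le hd C hn _).trans ?_
    gcongr
    exact Submodule.norm_orthogonalProjectionOnto_apply_le U v

/-- Two operators that agree on a subspace and on its orthogonal complement are equal. -/
theorem ContinuousLinearMap.ext_of_orthogonal (S : Submodule ℂ G₁) {A B : G₁ →L[ℂ] G₂}
    (h₁ : ∀ v ∈ S, A v = B v) (h₂ : ∀ v ∈ Sᗮ, A v = B v) : A = B := by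
  have h₁' : ∀ v ∈ S.topologicalClosure, A v = B v := by
    intro v hv
    exact closure_minimal (t := {v | A v = B v}) (fun v hv => h₁ v hv)
      (isClosed_eq A.continuous B.continuous) hv
  ext v
  have hv := Submodule.starProjection_add_starProjection_orthogonal (K := S.topologicalClosure) v
  rw [← hv, map_add, map_add, h₁' _ (Submodule.starProjection_apply_mem _ _),
    h₂ _ (by
      rw [← Submodule.orthogonal_closure]; exact Submodule.starProjection_apply_mem _ _)]

/-- The factorizing operator of `LinearMap.exists_clm_of_norm_le` intertwines operators that
come from the domain. -/
theorem ContinuousLinearMap.intertwines_of_range {f : E →ₗ[ℂ] G₁} {g : E →ₗ[ℂ] G₂}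
    {W : G₁ →L[ℂ] G₂} (hW : ∀ e, W (f e) = g e) (hW₀ : ∀ v ∈ (LinearMap.range f)ᗮ, W v = 0)
    {a₁ : G₁ →L[ℂ] G₁} {a₂ : G₂ →L[ℂ] G₂} (L L' : E → E) (h₁ : ∀ e, f (L e) = a₁ (f e))
    (h₂ : ∀ e, g (L e) = a₂ (g e)) (h₃ : ∀ e, f (L' e) = adjoint a₁ (f e)) :
    W ∘L a₁ = a₂ ∘L W := by
  refine ContinuousLinearMap.ext_of_orthogonal (LinearMap.range f) ?_ ?_
  · rintro _ ⟨e, rfl⟩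
    simp only [comp_apply, hW, ← h₁, h₂]
  · intro v hv
    have : a₁ v ∈ (LinearMap.range f)ᗮ := by
      rw [Submodule.mem_orthogonal] at hv ⊢
      rintro _ ⟨e, rfl⟩
      rw [← adjoint_inner_left, ← h₃]
      exact hv _ ⟨_, rfl⟩
    simp only [comp_apply, hW₀ _ hv, hW₀ _ this, map_zero]

/-- The absolute value of an operator between Hilbert spaces. -/
theorem ContinuousLinearMap.exists_abs [CompleteSpace G₂] (W : G₁ →L[ℂ] G₂) :
    ∃ a : G₁ →L[ℂ] G₁, (∀ v w, ⟪a v, a w⟫_ℂ = ⟪W v, W w⟫_ℂ) ∧ (∀ v, ‖a v‖ = ‖W v‖) ∧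
      adjoint a = a ∧ ∀ b, Commute (adjoint W ∘L W) b → Commute a b := by
  have hT : 0 ≤ adjoint W ∘L W :=
    (nonneg_iff_isPositive _).2 (isPositive_adjoint_comp_self W)
  have h := (IsSelfAdjoint.of_nonneg (CFC.sqrt_nonneg (adjoint W ∘L W))).adjoint_eq
  have key : ∀ v w, ⟪CFC.sqrt (adjoint W ∘L W) v, CFC.sqrt (adjoint W ∘L W) w⟫_ℂ
      = ⟪W v, W w⟫_ℂ := by
    intro v w
    rw [← adjoint_inner_right, h, ← adjoint_inner_right W]
    exact congrArg (fun S : G₁ →L[ℂ] G₁ => ⟪v, S w⟫_ℂ) (CFC.sqrt_mul_sqrt_self _ hT)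
  refine ⟨CFC.sqrt (adjoint W ∘L W), key, fun v => ?_, h, fun b hb => hb.cfcₙ_nnreal _⟩
  rw [norm_eq_sqrt_re_inner (𝕜 := ℂ), key, ← norm_eq_sqrt_re_inner]

/-- Taking adjoints in `h₂` gives `a W* = W* b`, so `W* W a = W* b W = a W* W`. Together with
`exists_abs`, this puts `|W|` in the commutant of whatever `W` intertwines. -/
theorem ContinuousLinearMap.commute_adjoint_comp_self [CompleteSpace G₂] {W : G₁ →L[ℂ] G₂}
    {a : G₁ →L[ℂ] G₁}
    {b : G₂ →L[ℂ] G₂} (h₁ : W ∘L a = b ∘L W) (h₂ : W ∘L adjoint a = adjoint b ∘L W) :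
    Commute (adjoint W ∘L W) a := by
  have h₃ := congrArg adjoint h₂
  rw [adjoint_comp, adjoint_comp, adjoint_adjoint, adjoint_adjoint] at h₃
  change (adjoint W ∘L W) ∘L a = a ∘L (adjoint W ∘L W)
  rw [comp_assoc, h₁, ← comp_assoc, ← h₃, comp_assoc]

/-- An operator commuting with a self-adjoint family preserving a subspace commutes with the
projection onto the closure. -/
theorem ContinuousLinearMap.starProjection_commute (S : Submodule ℂ G₁) [S.HasOrthogonalProjection]
    {a : G₁ →L[ℂ] G₁} (h₁ : ∀ v ∈ S, a v ∈ S) (h₂ : ∀ v ∈ S, adjoint a v ∈ S) (v : G₁) :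
    S.starProjection (a v) = a (S.starProjection v) := by
  refine Submodule.eq_starProjection_of_mem_of_inner_eq_zero
    (h₁ _ (Submodule.starProjection_apply_mem _ _)) fun w hw => ?_
  rw [← map_sub, ← adjoint_inner_right]
  exact Submodule.starProjection_inner_eq_zero _ _ (h₂ w hw)

end Hilbert

theorem Submodule.map_mem_topologicalClosure_of_invariant {G : Type*}
    [NormedAddCommGroup G] [InnerProductSpace ℂ G] (S : Submodule ℂ G) (a : G →L[ℂ] G)
    (h : ∀ v ∈ S, a v ∈ S) : ∀ v ∈ S.topologicalClosure, a v ∈ S.topologicalClosure := by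
  intro v hv
  exact map_mem_closure a.continuous hv h

/-! ### The countable amplification and its splitting into two copies of itself -/

section Amplification

variable {H : Type*} [NormedAddCommGroup H]

/-- The countable amplification of a Hilbert space. -/
abbrev Amplified (H : Type*) [NormedAddCommGroup H] : Type _ := lp (fun _ : ℕ => H) 2

namespace Amplified

theorem memℓp_iff {f : ℕ → H} : Memℓp f 2 ↔ Summable fun n => ‖f n‖ ^ 2 := by
  rw [memℓp_gen_iff (by norm_num)]
  simp

theorem norm_sq_eq (ξ : Amplified H) : HasSum (fun n => ‖ξ n‖ ^ 2) (‖ξ‖ ^ 2) := by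
  have := lp.hasSum_norm (p := 2) (by norm_num) ξ
  simpa using this

theorem ext_coord {ξ η : Amplified H} (h : ∀ n, ξ n = η n) : ξ = η := lp.ext (funext h)

theorem memℓp_comp {e : ℕ → ℕ} (he : Function.Injective e) (ξ : Amplified H) :
    Memℓp (fun n => ξ (e n)) 2 :=
  memℓp_iff.2 ((norm_sq_eq ξ).summable.comp_injective he)

variable [InnerProductSpace ℂ H]

/-- The coordinates of a vector of the amplification. -/
noncomputable def coord (n : ℕ) : Amplified H →L[ℂ] H := lp.evalCLM ℂ (fun _ : ℕ => H) 2 n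

theorem memℓp_map (T : H →L[ℂ] H) (ξ : Amplified H) : Memℓp (fun n => T (ξ n)) 2 := by
  rw [memℓp_iff]
  refine Summable.of_nonneg_of_le (fun n => by positivity) (fun n => ?_)
    ((norm_sq_eq ξ).summable.mul_left (‖T‖ ^ 2))
  rw [← mul_pow]
  gcongr
  exact T.le_opNorm _

/-- The diagonal operator on the amplification with diagonal entries `T`. -/
noncomputable def mapCLM (T : H →L[ℂ] H) : Amplified H →L[ℂ] Amplified H :=
  LinearMap.mkContinuous
    { toFun := fun ξ => ⟨fun n => T (ξ n), memℓp_map T ξ⟩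
      map_add' := fun ξ η => ext_coord fun n => map_add T (ξ n) (η n)
      map_smul' := fun c ξ => ext_coord fun n => map_smul T c (ξ n) } ‖T‖ (fun ξ => by
    refine le_of_sq_le_sq ?_ (by positivity)
    rw [mul_pow]
    refine hasSum_le (fun n => ?_) (norm_sq_eq _) ((norm_sq_eq ξ).mul_left (‖T‖ ^ 2))
    rw [← mul_pow]
    gcongr
    exact T.le_opNorm _)

@[simp]
theorem mapCLM_apply (T : H →L[ℂ] H) (ξ : Amplified H) (n : ℕ) : mapCLM T ξ n = T (ξ n) := rfl

/-- The restriction of a vector of the amplification along an injective map of indices. -/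
noncomputable def comapCLM (e : ℕ → ℕ) (he : Function.Injective e) :
    Amplified H →L[ℂ] Amplified H :=
  LinearMap.mkContinuous
    { toFun := fun ξ => ⟨fun n => ξ (e n), memℓp_comp he ξ⟩
      map_add' := fun ξ η => ext_coord fun n => rfl
      map_smul' := fun c ξ => ext_coord fun n => rfl } 1 (fun ξ => by
    refine le_of_sq_le_sq ?_ (by positivity)
    rw [one_mul, ← (norm_sq_eq ξ).tsum_eq, ← (norm_sq_eq _).tsum_eq]
    exact tsum_comp_le_tsum_of_inj (norm_sq_eq ξ).summable (fun n => by positivity) he)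

/-- The component of a vector at the even indices. -/
noncomputable def evenPart : Amplified H →L[ℂ] Amplified H :=
  comapCLM (fun n => 2 * n) fun _ _ h => by simpa using h

/-- The component of a vector at the odd indices. -/
noncomputable def oddPart : Amplified H →L[ℂ] Amplified H :=
  comapCLM (fun n => 2 * n + 1) fun _ _ h => by simpa using h

/-- Even and odd indices identify the amplification with its own direct sum square, so a sum of two
vector functionals is again a single vector functional. -/
theorem inner_eq_even_add_odd (ξ η : Amplified H) :
    ⟪ξ, η⟫_ℂ = ⟪evenPart ξ, evenPart η⟫_ℂ + ⟪oddPart ξ, oddPart η⟫_ℂ := by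
  let f : ℕ → ℂ := fun n => ⟪ξ n, η n⟫_ℂ
  have h : HasSum f ⟪ξ, η⟫_ℂ := lp.hasSum_inner ξ η
  have h₀ : HasSum (fun n => f (2 * n)) ⟪evenPart ξ, evenPart η⟫_ℂ := lp.hasSum_inner _ _
  have h₁ : HasSum (fun n => f (2 * n + 1)) ⟪oddPart ξ, oddPart η⟫_ℂ := lp.hasSum_inner _ _
  exact h.unique (h₀.even_add_odd h₁)

theorem exists_even_odd (α β : Amplified H) :
    ∃ χ : Amplified H, evenPart χ = α ∧ oddPart χ = β := by
  let f : ℕ → H := fun n => if n % 2 = 0 then α (n / 2) else β (n / 2)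
  have h₀ : ∀ n, f (2 * n) = α n := fun n => by simp [f]
  have h₁ : ∀ n, f (2 * n + 1) = β n := fun n => by
    have : (2 * n + 1) / 2 = n := by omega
    simp [f, this, Nat.add_mod]
  have hf : Memℓp f 2 := by
    rw [memℓp_iff]
    refine (HasSum.even_add_odd (f := fun n => ‖f n‖ ^ 2) (m := ‖α‖ ^ 2)
      (m' := ‖β‖ ^ 2) ?_ ?_).summable
    · simpa only [h₀] using norm_sq_eq α
    · simpa only [h₁] using norm_sq_eq β
  exact ⟨⟨f, hf⟩, ext_coord h₀, ext_coord h₁⟩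

variable [CompleteSpace H]

/-- The amplification of bounded operators. -/
noncomputable def amplify (H : Type*) [NormedAddCommGroup H] [InnerProductSpace ℂ H]
    [CompleteSpace H] : (H →L[ℂ] H) →⋆ₐ[ℂ] (Amplified H →L[ℂ] Amplified H) where
  toFun := mapCLM
  map_one' := ContinuousLinearMap.ext fun ξ => ext_coord fun n => by simp
  map_mul' S T := ContinuousLinearMap.ext fun ξ => ext_coord fun n => by simp
  map_zero' := ContinuousLinearMap.ext fun ξ => ext_coord fun n => by simp
  map_add' S T := ContinuousLinearMap.ext fun ξ => ext_coord fun n => by simp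
  commutes' r := ContinuousLinearMap.ext fun ξ => ext_coord fun n => by
    simp [Algebra.algebraMap_eq_smul_one]
  map_star' T := by
    refine (ContinuousLinearMap.eq_adjoint_iff _ _).2 fun ξ η => ?_
    rw [lp.inner_eq_tsum, lp.inner_eq_tsum]
    refine tsum_congr fun n => ?_
    rw [mapCLM_apply, mapCLM_apply, ContinuousLinearMap.star_eq_adjoint,
      ContinuousLinearMap.adjoint_inner_left]

theorem evenPart_amplify (T : H →L[ℂ] H) (ξ : Amplified H) :
    evenPart (amplify H T ξ) = amplify H T (evenPart ξ) := rfl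

theorem oddPart_amplify (T : H →L[ℂ] H) (ξ : Amplified H) :
    oddPart (amplify H T ξ) = amplify H T (oddPart ξ) := rfl

theorem amplify_mul_apply (S T : H →L[ℂ] H) (ξ : Amplified H) :
    amplify H (S * T) ξ = amplify H S (amplify H T ξ) := rfl

theorem adjoint_amplify (T : H →L[ℂ] H) :
    ContinuousLinearMap.adjoint (amplify H T) = amplify H (star T) :=
  (map_star (amplify H) T).symm

theorem inner_amplify_left (T : H →L[ℂ] H) (ξ η : Amplified H) :
    ⟪amplify H T ξ, η⟫_ℂ = ⟪ξ, amplify H (star T) η⟫_ℂ := by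
  rw [← adjoint_amplify, ContinuousLinearMap.adjoint_inner_right]

theorem norm_amplify_le (T : H →L[ℂ] H) : ‖amplify H T‖ ≤ ‖T‖ :=
  NonUnitalStarAlgHom.norm_apply_le (amplify H) T

end Amplified

end Amplification

/-! ### Normal functionals and normal states as vector functionals -/

namespace VonNeumannAlgebra

open Amplified

variable {H : Type*} [NormedAddCommGroup H] [InnerProductSpace ℂ H] [CompleteSpace H]

/-- The normal functional `x ↦ ⟪η, x ξ⟫` given by two vectors of the amplification. -/
noncomputable def vectorFunctional (M : VonNeumannAlgebra H) (p : Amplified H × Amplified H) :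
    M →ₗ[ℂ] ℂ where
  toFun x := ⟪p.2, amplify H (x : H →L[ℂ] H) p.1⟫_ℂ
  map_add' x y := by
    rw [AddMemClass.coe_add, map_add, add_apply, inner_add_right]
  map_smul' c x := by
    have : ((c • x : M) : H →L[ℂ] H) = c • (x : H →L[ℂ] H) := rfl
    rw [this, map_smul, smul_apply, inner_smul_right]
    rfl

theorem ultraweak_eq (M : VonNeumannAlgebra H) :
    M.ultraweak = ⨅ p : Amplified H × Amplified H,
      TopologicalSpace.induced (M.vectorFunctional p) inferInstance := by
  refine iInf_congr fun p => ?_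
  have h : (fun x : M => ∑' n, ⟪p.2 n, (x : H →L[ℂ] H) (p.1 n)⟫_ℂ) = M.vectorFunctional p :=
    funext fun x => (lp.inner_eq_tsum p.2 (amplify H (x : H →L[ℂ] H) p.1)).symm
  rw [← h]

/-- An ultraweakly continuous functional is given by two vectors of the amplification. -/
theorem exists_eq_vectorFunctional {M : VonNeumannAlgebra H} {φ : M →ₗ[ℂ] ℂ}
    (hφ : Continuous[M.ultraweak, inferInstance] φ) : ∃ p, φ = M.vectorFunctional p := by
  rw [ultraweak_eq] at hφ
  have := (LinearMap.mem_span_iff_continuous φ).2 hφ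
  clear hφ
  induction this using Submodule.span_induction with
  | mem φ h => obtain ⟨p, rfl⟩ := h; exact ⟨p, rfl⟩
  | zero => exact ⟨0, by ext x; simp [vectorFunctional]⟩
  | add φ ψ _ _ h₁ h₂ =>
    obtain ⟨⟨ξ₁, η₁⟩, rfl⟩ := h₁
    obtain ⟨⟨ξ₂, η₂⟩, rfl⟩ := h₂
    obtain ⟨ξ, rfl, rfl⟩ := exists_even_odd ξ₁ ξ₂
    obtain ⟨η, rfl, rfl⟩ := exists_even_odd η₁ η₂
    refine ⟨(ξ, η), ?_⟩
    ext x
    exact (inner_eq_even_add_odd η (amplify H (x : H →L[ℂ] H) ξ)).symm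
  | smul c φ _ h =>
    obtain ⟨⟨ξ, η⟩, rfl⟩ := h
    refine ⟨(c • ξ, η), ?_⟩
    ext x
    simp [vectorFunctional]

/-- A normal state is a vector state of the amplification. -/
theorem IsNormalState.exists_vector {M : VonNeumannAlgebra H} {ω : M →ₗ[ℂ] ℂ}
    (hω : M.IsNormalState ω) :
    ∃ ξ : Amplified H, ∀ x : M, ω x = ⟪ξ, amplify H (x : H →L[ℂ] H) ξ⟫_ℂ := by
  obtain ⟨⟨ξ₀, η₀⟩, h₀⟩ := exists_eq_vectorFunctional hω.normal
  -- By polarization `Re ⟪x η₀, x ξ₀⟫ ≤ ‖x (ξ₀ + η₀)‖² / 4`, so `ω (x* x)` is dominated by the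
  -- vector state of this sum; the constant 1 used below is not sharp.
  obtain ⟨ζ, hζ⟩ : ∃ ζ, ζ = ξ₀ + η₀ := ⟨_, rfl⟩
  let φ : M →ₚ[ℂ] ℂ := PositiveLinearMap.mk₀ ω hω.nonneg
  let g : M →ₗ[ℂ] φ.GNS :=
    (UniformSpace.Completion.toComplL (𝕜 := ℂ) (E := φ.PreGNS)).toLinearMap ∘ₗ
      φ.toPreGNS.toLinearMap
  have hg : ∀ x y, ⟪g x, g y⟫_ℂ = ω (star x * y) := fun x y =>
    (UniformSpace.Completion.inner_coe _ _).trans (φ.preGNS_inner_def _ _)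
  let f : M →ₗ[ℂ] Amplified H :=
    { toFun := fun x => amplify H (x : H →L[ℂ] H) ζ
      map_add' := fun x y => by rw [AddMemClass.coe_add, map_add, add_apply]
      map_smul' := fun c x => by
        have : ((c • x : M) : H →L[ℂ] H) = c • (x : H →L[ℂ] H) := rfl
        rw [this, map_smul, smul_apply, RingHom.id_apply] }
  have hfg : ∀ x, ‖g x‖ ≤ 1 * ‖f x‖ := by
    intro x
    rw [one_mul]
    refine le_of_sq_le_sq ?_ (norm_nonneg _)
    rw [← inner_self_eq_norm_sq (𝕜 := ℂ), hg, h₀]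
    set u := amplify H (x : H →L[ℂ] H) ξ₀
    set v := amplify H (x : H →L[ℂ] H) η₀
    have h₁ : M.vectorFunctional (ξ₀, η₀) (star x * x) = ⟪v, u⟫_ℂ := by
      change ⟪η₀, amplify H (star (x : H →L[ℂ] H) * x) ξ₀⟫_ℂ = _
      rw [amplify_mul_apply, ← inner_amplify_left]
    have h₂ : f x = u + v := by
      change amplify H (x : H →L[ℂ] H) ζ = _
      rw [hζ, map_add]
    rw [h₁, h₂]
    have h₃ := norm_add_sq (𝕜 := ℂ) u v
    have h₄ := norm_sub_sq (𝕜 := ℂ) u v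
    rw [inner_re_symm] at h₃ h₄
    nlinarith [sq_nonneg ‖u - v‖, sq_nonneg ‖u + v‖]
  obtain ⟨W, hW, hW₀, -⟩ := LinearMap.exists_clm_of_norm_le f g zero_le_one hfg
  have hWc : ∀ y : M, W ∘L amplify H (y : H →L[ℂ] H) = φ.gnsStarAlgHom y ∘L W := by
    intro y
    refine ContinuousLinearMap.intertwines_of_range hW hW₀ (fun x => y * x) (fun x => star y * x)
      (fun x => rfl) (fun x => ?_) (fun x => ?_)
    · exact (φ.gnsNonUnitalStarAlgHom_apply_coe (a := y) (b := φ.toPreGNS x)).symm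
    · rw [adjoint_amplify]; rfl
  obtain ⟨a, ha, -, -, hac⟩ := W.exists_abs
  have hc : ∀ y : M, Commute a (amplify H (y : H →L[ℂ] H)) := by
    intro y
    refine hac _ (ContinuousLinearMap.commute_adjoint_comp_self (hWc y) ?_)
    rw [adjoint_amplify, ← ContinuousLinearMap.star_eq_adjoint, ← map_star]
    exact hWc (star y)
  -- As `a = |W|` commutes with `M`, `⟪a ζ, x a ζ⟫ = ⟪W ζ, W x ζ⟫`, which is the GNS inner product
  -- of the classes of `1` and `x`.
  refine ⟨a ζ, fun x => ?_⟩
  have h₁ : amplify H (x : H →L[ℂ] H) (a ζ) = a (amplify H (x : H →L[ℂ] H) ζ) :=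
    (DFunLike.congr_fun (hc x).eq ζ).symm
  rw [h₁, ha]
  have h₂ : W ζ = g 1 := by
    rw [← hW]
    congr 1
  have h₃ := hg 1 x
  rw [star_one, one_mul, ← hW x, ← h₂] at h₃
  exact h₃.symm

/-! ### The support projection of a vector state -/

/-- The operators from the amplification to the Hilbert space that intertwine the actions of a
von Neumann algebra. -/
noncomputable def intertwiners (N : VonNeumannAlgebra H) : Submodule ℂ (Amplified H →L[ℂ] H) where
  carrier := {c | ∀ d ∈ N, ∀ v, c (amplify H d v) = d (c v)}
  add_mem' {a b} ha hb d hd v := by simp [ha d hd v, hb d hd v]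
  zero_mem' d hd v := by simp
  smul_mem' r c hc d hd v := by simp [hc d hd v]

theorem coord_mem_intertwiners (N : VonNeumannAlgebra H) (n : ℕ) :
    coord n ∈ N.intertwiners := fun _ _ _ => rfl

theorem comp_mem_intertwiners {N : VonNeumannAlgebra H} {b : H →L[ℂ] H} (hb : b ∈ N.commutant)
    {c : Amplified H →L[ℂ] H} (hc : c ∈ N.intertwiners) : b ∘L c ∈ N.intertwiners := by
  intro d hd v
  rw [ContinuousLinearMap.comp_apply, hc d hd v]
  exact (DFunLike.congr_fun (mem_commutant_iff.1 hb d hd) (c v)).symm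

/-- The evaluation of intertwiners at a vector. -/
noncomputable def evalAt (N : VonNeumannAlgebra H) (ξ : Amplified H) : N.intertwiners →ₗ[ℂ] H where
  toFun c := (c : Amplified H →L[ℂ] H) ξ
  map_add' _ _ := rfl
  map_smul' _ _ := rfl

/-- The closure of the orbit of a vector under the intertwiners. -/
noncomputable def supportSpace (N : VonNeumannAlgebra H) (ξ : Amplified H) : Submodule ℂ H :=
  (LinearMap.range (N.evalAt ξ)).topologicalClosure

instance (N : VonNeumannAlgebra H) (ξ : Amplified H) : CompleteSpace (N.supportSpace ξ) :=
  (Submodule.isClosed_topologicalClosure _).completeSpace_coe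

/-- The support projection of the vector state of `ξ` on `N`. -/
noncomputable def supportProj (N : VonNeumannAlgebra H) (ξ : Amplified H) : H →L[ℂ] H :=
  (N.supportSpace ξ).starProjection

theorem isStarProjection_supportProj (N : VonNeumannAlgebra H) (ξ : Amplified H) :
    IsStarProjection (N.supportProj ξ) :=
  isStarProjection_starProjection

/-- Intertwiners may be composed on the left with operators of the commutant, so the support space
is invariant under `N'` and its projection lies in `N''`. -/
theorem supportProj_mem (N : VonNeumannAlgebra H) (ξ : Amplified H) : N.supportProj ξ ∈ N := by
  have key : ∀ b ∈ N.commutant, ∀ v ∈ N.supportSpace ξ, b v ∈ N.supportSpace ξ := by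
    intro b hb
    refine Submodule.map_mem_topologicalClosure_of_invariant _ b ?_
    rintro _ ⟨c, rfl⟩
    exact ⟨⟨b ∘L c, comp_mem_intertwiners hb c.2⟩, rfl⟩
  suffices h : N.supportProj ξ ∈ N.commutant.commutant by rwa [N.commutant_commutant] at h
  rw [mem_commutant_iff]
  intro b hb
  ext v
  exact (ContinuousLinearMap.starProjection_commute _ (key b hb)
    (key _ (star_mem hb)) v).symm

theorem supportProj_apply_intertwiner {N : VonNeumannAlgebra H} (ξ : Amplified H)
    {c : Amplified H →L[ℂ] H} (hc : c ∈ N.intertwiners) : N.supportProj ξ (c ξ) = c ξ :=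
  Submodule.starProjection_eq_self_iff.2
    (Submodule.le_topologicalClosure _ ⟨⟨c, hc⟩, rfl⟩)

theorem amplify_supportProj (N : VonNeumannAlgebra H) (ξ : Amplified H) :
    amplify H (N.supportProj ξ) ξ = ξ :=
  ext_coord fun n => supportProj_apply_intertwiner ξ (N.coord_mem_intertwiners n)

/-- If `d ξ = 0`, then `d c ξ = c d ξ = 0` for each intertwiner `c`, so `d` vanishes on the support
space. The converse holds because the coordinates are intertwiners, so that the support projection
fixes `ξ`. -/
theorem mul_supportProj_eq_zero_iff {N : VonNeumannAlgebra H} (ξ : Amplified H)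
    {d : H →L[ℂ] H} (hd : d ∈ N) : d * N.supportProj ξ = 0 ↔ amplify H d ξ = 0 := by
  constructor
  · intro h
    rw [← amplify_supportProj N ξ, ← amplify_mul_apply, h, map_zero]; rfl
  · intro h
    ext v
    have : ∀ w ∈ N.supportSpace ξ, d w = 0 := by
      intro w hw
      refine closure_minimal (t := {w | d w = 0}) ?_ (isClosed_eq d.continuous continuous_const) hw
      rintro _ ⟨c, rfl⟩
      change d (c.1 ξ) = 0
      rw [← c.2 d hd, h, map_zero]
    exact this _ (Submodule.starProjection_apply_mem _ v)

theorem isSupportProjection_supportProj {M N : VonNeumannAlgebra H} (hN : N ≤ M) {ω : M → ℂ}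
    {ξ : Amplified H} (hω : ∀ x : M, ω x = ⟪ξ, amplify H (x : H →L[ℂ] H) ξ⟫_ℂ) :
    IsSupportProjection N ω (⟨N.supportProj ξ, hN (N.supportProj_mem ξ)⟩ : M) := by
  have hz := N.isStarProjection_supportProj ξ
  constructor
  · refine ⟨sub_mem (one_mem N) (N.supportProj_mem ξ), ?_, ?_⟩
    · refine IsStarProjection.one_sub ⟨Subtype.ext hz.1, Subtype.ext hz.2⟩
    · rw [hω]
      change ⟪ξ, amplify H (1 - N.supportProj ξ) ξ⟫_ℂ = 0
      rw [map_sub, sub_apply, amplify_supportProj, map_one]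
      simp
  · rintro p ⟨hpN, hp, h⟩
    have hp' : IsStarProjection (p : H →L[ℂ] H) :=
      ⟨congrArg Subtype.val hp.1, congrArg Subtype.val hp.2⟩
    have h₁ : amplify H (p : H →L[ℂ] H) ξ = 0 := by
      rw [hω, ← hp'.1.eq, amplify_mul_apply, ← hp'.2.star_eq, ← inner_amplify_left,
        hp'.2.star_eq] at h
      exact inner_self_eq_zero.1 h
    rw [← mul_supportProj_eq_zero_iff ξ hpN] at h₁
    have h₂ : (p : H →L[ℂ] H) ≤ 1 - N.supportProj ξ :=
      hp'.le_of_mul_eq_left hz.one_sub (by rw [mul_sub, h₁, mul_one, sub_zero])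
    exact h₂

end VonNeumannAlgebra

/-! ### Cyclic subspaces and existence of the expectation -/

namespace VonNeumannAlgebra

open Amplified Filter

variable {H : Type*} [NormedAddCommGroup H] [InnerProductSpace ℂ H] [CompleteSpace H]

/-- The orbit map of a vector of the amplification under a von Neumann algebra. -/
noncomputable def orbitMap (D : VonNeumannAlgebra H) (ξ : Amplified H) : D →ₗ[ℂ] Amplified H where
  toFun d := amplify H (d : H →L[ℂ] H) ξ
  map_add' x y := by rw [AddMemClass.coe_add, map_add, add_apply]
  map_smul' c x := by
    have : ((c • x : D) : H →L[ℂ] H) = c • (x : H →L[ℂ] H) := rfl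
    rw [this, map_smul, smul_apply, RingHom.id_apply]

/-- The cyclic subspace generated by a vector of the amplification. -/
noncomputable def cyclicSpace (D : VonNeumannAlgebra H) (ξ : Amplified H) :
    Submodule ℂ (Amplified H) :=
  (LinearMap.range (D.orbitMap ξ)).topologicalClosure

instance (D : VonNeumannAlgebra H) (ξ : Amplified H) : CompleteSpace (D.cyclicSpace ξ) :=
  (Submodule.isClosed_topologicalClosure _).completeSpace_coe

theorem amplify_mem_cyclicSpace {D : VonNeumannAlgebra H} (ξ : Amplified H) {d : H →L[ℂ] H}
    (hd : d ∈ D) : amplify H d ξ ∈ D.cyclicSpace ξ :=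
  Submodule.le_topologicalClosure _ ⟨⟨d, hd⟩, rfl⟩

theorem self_mem_cyclicSpace (D : VonNeumannAlgebra H) (ξ : Amplified H) :
    ξ ∈ D.cyclicSpace ξ := by
  have := amplify_mem_cyclicSpace (D := D) ξ (one_mem D)
  rwa [map_one] at this

theorem exists_seq_of_mem_cyclicSpace {D : VonNeumannAlgebra H} {ξ v : Amplified H}
    (hv : v ∈ D.cyclicSpace ξ) :
    ∃ d : ℕ → H →L[ℂ] H, (∀ n, d n ∈ D) ∧
      Tendsto (fun n => amplify H (d n) ξ) atTop (𝓝 v) := by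
  obtain ⟨u, hu, hlim⟩ := mem_closure_iff_seq_limit.1 hv
  choose d hd using hu
  refine ⟨fun n => d n, fun n => (d n).2, ?_⟩
  convert hlim using 2 with n
  exact hd n

/-- A closed property that holds on an orbit holds on the cyclic subspace. -/
theorem cyclicSpace_induction {D : VonNeumannAlgebra H} {ξ : Amplified H} {p : Amplified H → Prop}
    (hp : IsClosed {v | p v}) (h : ∀ d ∈ D, p (amplify H d ξ)) {v : Amplified H}
    (hv : v ∈ D.cyclicSpace ξ) : p v := by
  refine closure_minimal (t := {v | p v}) ?_ hp hv
  rintro _ ⟨d, rfl⟩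
  exact h d d.2

theorem amplify_mem_cyclicSpace_of_mem {D : VonNeumannAlgebra H} {ξ : Amplified H}
    {d : H →L[ℂ] H} (hd : d ∈ D) {v : Amplified H} (hv : v ∈ D.cyclicSpace ξ) :
    amplify H d v ∈ D.cyclicSpace ξ := by
  refine cyclicSpace_induction (p := fun v => amplify H d v ∈ D.cyclicSpace ξ)
    ((Submodule.isClosed_topologicalClosure _).preimage (amplify H d).continuous) ?_ hv
  intro e he
  rw [← amplify_mul_apply]
  exact amplify_mem_cyclicSpace ξ (mul_mem hd he)

theorem starProjection_cyclicSpace_amplify {D : VonNeumannAlgebra H} (ξ : Amplified H)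
    {d : H →L[ℂ] H} (hd : d ∈ D) (v : Amplified H) :
    (D.cyclicSpace ξ).starProjection (amplify H d v) =
      amplify H d ((D.cyclicSpace ξ).starProjection v) := by
  refine ContinuousLinearMap.starProjection_commute _
    (fun v hv => amplify_mem_cyclicSpace_of_mem hd hv) (fun v hv => ?_) v
  rw [adjoint_amplify]
  exact amplify_mem_cyclicSpace_of_mem (star_mem hd) hv

/-- The vector state of `ξ` on `M` has `D` in its centralizer. -/
def IsCentralizing (M D : VonNeumannAlgebra H) (ξ : Amplified H) : Prop :=
  ∀ a ∈ D, ∀ x ∈ M, ⟪ξ, amplify H (a * x) ξ⟫_ℂ = ⟪ξ, amplify H (x * a) ξ⟫_ℂ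

variable {M D : VonNeumannAlgebra H} {ξ : Amplified H}

namespace IsCentralizing

theorem norm_star_apply (h : IsCentralizing M D ξ) (hDM : D ≤ M) {d : H →L[ℂ] H} (hd : d ∈ D) :
    ‖amplify H (star d) ξ‖ = ‖amplify H d ξ‖ := by
  have h₁ := h d hd (star d) (hDM (star_mem hd))
  have h₂ : ∀ e : H →L[ℂ] H, ⟪ξ, amplify H (star e * e) ξ⟫_ℂ =
      ⟪amplify H e ξ, amplify H e ξ⟫_ℂ := fun e => by
    rw [amplify_mul_apply, inner_amplify_left]
  have h₃ := h₂ (star d)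
  rw [star_star, h₁, h₂] at h₃
  rw [norm_eq_sqrt_re_inner (𝕜 := ℂ), ← h₃, ← norm_eq_sqrt_re_inner]

/-- By `norm_star_apply`, `e ξ = 0` forces `e* ξ = 0`; thus `e z = 0` implies `z e = 0`. Applied to
`e (1 - z)` this gives `z e = z e z`, and the adjoint identity gives centrality. -/
theorem supportProj_commute (h : IsCentralizing M D ξ) (hDM : D ≤ M) {d : H →L[ℂ] H} (hd : d ∈ D) :
    D.supportProj ξ * d = d * D.supportProj ξ := by
  set z := D.supportProj ξ with hz
  have hzs := D.isStarProjection_supportProj ξ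
  have hzD := D.supportProj_mem ξ
  have key : ∀ e ∈ D, e * z = 0 → z * e = 0 := by
    intro e he h₁
    rw [mul_supportProj_eq_zero_iff ξ he, ← norm_eq_zero, ← h.norm_star_apply hDM he,
      norm_eq_zero, ← mul_supportProj_eq_zero_iff ξ (star_mem he)] at h₁
    have := congrArg star h₁
    rwa [star_mul, star_star, star_zero, hzs.2.star_eq] at this
  have key₂ : ∀ e ∈ D, z * e = z * (e * z) := by
    intro e he
    have := key (e * (1 - z)) (mul_mem he (sub_mem (one_mem D) hzD)) (by
      rw [mul_assoc, hzs.one_sub_mul_self, mul_zero])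
    rwa [mul_sub, mul_sub, mul_one, sub_eq_zero] at this
  have hzz : star z = z := hzs.2.star_eq
  have h₂ := congrArg star (key₂ (star d) (star_mem hd))
  simp only [star_mul, star_star, hzz] at h₂
  rw [key₂ d hd, ← mul_assoc, ← h₂]

/-- The cyclic projection compresses `M` and the commutant of `D` symmetrically. -/
theorem inner_compression (h : IsCentralizing M D ξ) (hDM : D ≤ M)
    {C : Amplified H →L[ℂ] Amplified H} (hC : ∀ d ∈ D, ∀ v, C (amplify H d v) = amplify H d (C v))
    {y : H →L[ℂ] H} (hy : y ∈ M) :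
    ⟪ξ, amplify H y ((D.cyclicSpace ξ).starProjection (C ξ))⟫_ℂ =
      ⟪ξ, C ((D.cyclicSpace ξ).starProjection (amplify H y ξ))⟫_ℂ := by
  set P := (D.cyclicSpace ξ).starProjection with hP
  obtain ⟨d, hd, hlim⟩ := exists_seq_of_mem_cyclicSpace
    (Submodule.starProjection_apply_mem (D.cyclicSpace ξ) (C ξ))
  -- The adjoint is isometric on the orbit `D ξ`, so convergence of `d n ξ` passes to `(d n)* ξ`.
  have hcauchy : CauchySeq fun n => amplify H (star (d n)) ξ := by
    have h₁ := hlim.cauchySeq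
    rw [Metric.cauchySeq_iff] at h₁ ⊢
    intro ε hε
    obtain ⟨N, hN⟩ := h₁ ε hε
    refine ⟨N, fun m hm n hn => ?_⟩
    have h₂ := hN m hm n hn
    rw [dist_eq_norm, ← sub_apply, ← map_sub] at h₂ ⊢
    rwa [← star_sub, h.norm_star_apply hDM (sub_mem (hd m) (hd n))]
  obtain ⟨w, hw⟩ := cauchySeq_tendsto_of_complete hcauchy
  have hwU : w ∈ D.cyclicSpace ξ :=
    (Submodule.isClosed_topologicalClosure _).mem_of_tendsto hw
      (Eventually.of_forall fun n => amplify_mem_cyclicSpace ξ (star_mem (hd n)))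
  -- The limit is identified by pairing with `e ξ`, where traciality replaces `ω (d n e)` by `ω (e d
  -- n)`.
  have hwP : P (ContinuousLinearMap.adjoint C ξ) = w := by
    refine Submodule.eq_starProjection_of_mem_of_inner_eq_zero hwU fun u hu => ?_
    refine cyclicSpace_induction (p := fun u => ⟪_, u⟫_ℂ = 0)
      (isClosed_eq (by fun_prop) continuous_const) (fun e he => ?_) hu
    have h₁ : Tendsto (fun n => ⟪amplify H (star (d n)) ξ, amplify H e ξ⟫_ℂ) atTop
        (𝓝 ⟪w, amplify H e ξ⟫_ℂ) := hw.inner tendsto_const_nhds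
    have h₂ : Tendsto (fun n => ⟪amplify H (star e) ξ, amplify H (d n) ξ⟫_ℂ) atTop
        (𝓝 ⟪amplify H (star e) ξ, P (C ξ)⟫_ℂ) := tendsto_const_nhds.inner hlim
    have h₃ : ∀ n, ⟪amplify H (star (d n)) ξ, amplify H e ξ⟫_ℂ =
        ⟪amplify H (star e) ξ, amplify H (d n) ξ⟫_ℂ := by
      intro n
      rw [inner_amplify_left, inner_amplify_left, star_star, star_star, ← amplify_mul_apply,
        ← amplify_mul_apply]
      exact h _ (hd n) _ (hDM he)
    simp only [h₃] at h₁
    have h₄ := tendsto_nhds_unique h₁ h₂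
    rw [inner_sub_left, h₄, ContinuousLinearMap.adjoint_inner_left, hC e he,
      ← Submodule.inner_starProjection_left_eq_right, Submodule.starProjection_eq_self_iff.2
        (amplify_mem_cyclicSpace ξ (star_mem he)), inner_amplify_left, star_star, sub_self]
  have h₁ : Tendsto (fun n => ⟪ξ, amplify H y (amplify H (d n) ξ)⟫_ℂ) atTop
      (𝓝 ⟪ξ, amplify H y (P (C ξ))⟫_ℂ) :=
    tendsto_const_nhds.inner (((amplify H y).continuous.tendsto _).comp hlim)
  have h₂ : Tendsto (fun n => ⟪amplify H (star (d n)) ξ, amplify H y ξ⟫_ℂ) atTop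
      (𝓝 ⟪w, amplify H y ξ⟫_ℂ) := hw.inner tendsto_const_nhds
  have h₃ : ∀ n, ⟪amplify H (star (d n)) ξ, amplify H y ξ⟫_ℂ =
      ⟪ξ, amplify H y (amplify H (d n) ξ)⟫_ℂ := by
    intro n
    rw [inner_amplify_left, star_star, ← amplify_mul_apply, ← amplify_mul_apply]
    exact h _ (hd n) _ hy
  simp only [h₃] at h₂
  rw [tendsto_nhds_unique h₁ h₂, ← hwP, hP, Submodule.inner_starProjection_left_eq_right,
    ContinuousLinearMap.adjoint_inner_left]

/-- The matrix coefficients of both products between `d₂ ξ` and `d₁ ξ` are compared by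
`inner_compression` at `y = d₂* x d₁`, and such vectors are dense in the range of the projection. -/
theorem commute_compression (h : IsCentralizing M D ξ) (hDM : D ≤ M)
    {C : Amplified H →L[ℂ] Amplified H} (hC : ∀ d ∈ D, ∀ v, C (amplify H d v) = amplify H d (C v))
    {x : H →L[ℂ] H} (hx : x ∈ M) :
    Commute ((D.cyclicSpace ξ).starProjection ∘L C ∘L (D.cyclicSpace ξ).starProjection)
      ((D.cyclicSpace ξ).starProjection ∘L amplify H x ∘L (D.cyclicSpace ξ).starProjection) := by
  set P := (D.cyclicSpace ξ).starProjection with hP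
  have hPP : ∀ v, P (P v) = P v := fun v =>
    Submodule.starProjection_eq_self_iff.2 (Submodule.starProjection_apply_mem _ v)
  have hPd : ∀ d ∈ D, P (amplify H d ξ) = amplify H d ξ := fun d hd =>
    Submodule.starProjection_eq_self_iff.2 (amplify_mem_cyclicSpace ξ hd)
  have hPc : ∀ d ∈ D, ∀ v, P (amplify H d v) = amplify H d (P v) := fun d hd =>
    starProjection_cyclicSpace_amplify ξ hd
  have key : ∀ v ∈ D.cyclicSpace ξ, P (C (P (amplify H x v))) = P (amplify H x (P (C v))) := by
    intro v hv
    refine cyclicSpace_induction (p := fun v => P (C (P (amplify H x v))) =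
      P (amplify H x (P (C v)))) (isClosed_eq (by fun_prop) (by fun_prop)) (fun d₁ hd₁ => ?_) hv
    rw [← sub_eq_zero, ← map_sub, hP, Submodule.starProjection_apply_eq_zero_iff,
      Submodule.mem_orthogonal, ← hP]
    intro u hu
    refine cyclicSpace_induction (p := fun u => ⟪u, _⟫_ℂ = 0)
      (isClosed_eq (by fun_prop) continuous_const) (fun d₂ hd₂ => ?_) hu
    have h₁ := h.inner_compression hDM hC
      (y := star d₂ * x * d₁) (mul_mem (mul_mem (hDM (star_mem hd₂)) hx) (hDM hd₁))
    rw [← hP] at h₁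
    rw [inner_sub_right, inner_amplify_left, inner_amplify_left, ← hC _ (star_mem hd₂),
      ← hPc _ (star_mem hd₂), hC _ hd₁, hPc _ hd₁, ← amplify_mul_apply, ← amplify_mul_apply,
      ← amplify_mul_apply, ← amplify_mul_apply, h₁, sub_self]
  refine ContinuousLinearMap.ext fun v => ?_
  change P (C (P (P (amplify H x (P v))))) = P (amplify H x (P (P (C (P v)))))
  rw [hPP, hPP]
  exact key _ (Submodule.starProjection_apply_mem _ v)

/-- The Radon–Nikodym type statement that provides the values of the conditional expectation. -/
theorem exists_expectation (h : IsCentralizing M D ξ) (hDM : D ≤ M) {x : H →L[ℂ] H} (hx : x ∈ M) :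
    ∃ y ∈ D, y * D.supportProj ξ = y ∧ ‖y‖ ≤ ‖x‖ ∧
      ∀ d ∈ D, ⟪ξ, amplify H (d * y) ξ⟫_ℂ = ⟪ξ, amplify H (d * x) ξ⟫_ℂ := by
  set P := (D.cyclicSpace ξ).starProjection with hP
  have hPξ : P ξ = ξ := Submodule.starProjection_eq_self_iff.2 (self_mem_cyclicSpace D ξ)
  have hPP : ∀ v, P (P v) = P v := fun v =>
    Submodule.starProjection_eq_self_iff.2 (Submodule.starProjection_apply_mem _ v)
  have hPadj : ContinuousLinearMap.adjoint P = P :=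
    isStarProjection_starProjection.2.adjoint_eq
  set T := P ∘L amplify H x ∘L P with hT
  have hTn : ‖T‖ ≤ ‖x‖ := by
    refine ContinuousLinearMap.opNorm_le_bound _ (norm_nonneg _) fun v => ?_
    calc ‖P (amplify H x (P v))‖ ≤ ‖amplify H x (P v)‖ := Submodule.norm_starProjection_apply_le _ _
      _ ≤ ‖x‖ * ‖P v‖ := (amplify H x).le_of_opNorm_le (norm_amplify_le x) _
      _ ≤ ‖x‖ * ‖v‖ := by gcongr; exact Submodule.norm_starProjection_apply_le _ _
  have hTξ : T ξ = P (amplify H x ξ) := by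
    rw [hT, ContinuousLinearMap.comp_apply, ContinuousLinearMap.comp_apply, hPξ]
  have hnorm : ∀ c : D.intertwiners, ‖D.evalAt (T ξ) c‖ ≤ ‖x‖ * ‖D.evalAt ξ c‖ := by
    rintro ⟨c, hc⟩
    change ‖c (T ξ)‖ ≤ ‖x‖ * ‖c ξ‖
    -- `|c P|` commutes with `T` since `P c* c P` does; hence `‖c T ξ‖ = ‖|c P| T ξ‖ = ‖T |c P| ξ‖ ≤
    -- ‖x‖ ‖c ξ‖`.
    obtain ⟨a, -, ha, -, hac⟩ := (c ∘L P).exists_abs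
    have hcomm : Commute a T := by
      refine hac _ ?_
      rw [ContinuousLinearMap.adjoint_comp, hPadj]
      refine h.commute_compression hDM (C := ContinuousLinearMap.adjoint c ∘L c) ?_ hx
      intro d hd v
      refine DFunLike.congr_fun (ContinuousLinearMap.commute_adjoint_comp_self (W := c)
        (a := amplify H d) (b := d) ?_ ?_).eq v
      · ext v; exact hc d hd v
      · rw [adjoint_amplify]; ext v; exact hc _ (star_mem hd) v
    have h₁ : c (T ξ) = (c ∘L P) (T ξ) := by
      rw [hTξ, ContinuousLinearMap.comp_apply, hPP]
    have h₂ : c ξ = (c ∘L P) ξ := by rw [ContinuousLinearMap.comp_apply, hPξ]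
    rw [h₁, h₂, ← ha, ← ha]
    have h₃ : a (T ξ) = T (a ξ) := DFunLike.congr_fun hcomm.eq ξ
    rw [h₃]
    exact T.le_of_opNorm_le hTn _
  obtain ⟨y, hy, hy₀, hyn⟩ := LinearMap.exists_clm_of_norm_le (D.evalAt ξ) (D.evalAt (T ξ))
    (norm_nonneg x) hnorm
  have hyD : y ∈ D := by
    suffices hs : y ∈ D.commutant.commutant by rwa [D.commutant_commutant] at hs
    rw [mem_commutant_iff]
    intro b hb
    refine (ContinuousLinearMap.intertwines_of_range hy hy₀
      (fun c => ⟨b ∘L c, comp_mem_intertwiners hb c.2⟩)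
      (fun c => ⟨star b ∘L c, comp_mem_intertwiners (star_mem hb) c.2⟩)
      (fun _ => rfl) (fun _ => rfl) (fun _ => rfl)).symm
  -- The defining relation `y (c ξ) = c (T ξ)`, read at the coordinate intertwiners.
  have hyξ : amplify H y ξ = T ξ :=
    ext_coord fun n => hy ⟨coord n, D.coord_mem_intertwiners n⟩
  refine ⟨y, hyD, ?_, hyn, fun d hd => ?_⟩
  · ext v
    have h₁ : v - D.supportProj ξ v ∈ (LinearMap.range (D.evalAt ξ))ᗮ := by
      rw [← Submodule.orthogonal_closure]
      exact Submodule.sub_starProjection_mem_orthogonal v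
    have h₂ := hy₀ _ h₁
    rw [map_sub, sub_eq_zero] at h₂
    exact h₂.symm
  · rw [amplify_mul_apply, amplify_mul_apply, hyξ, hTξ, ← star_star d, ← inner_amplify_left,
      ← inner_amplify_left, ← Submodule.inner_starProjection_left_eq_right,
      Submodule.starProjection_eq_self_iff.2 (amplify_mem_cyclicSpace ξ (star_mem hd))]

end IsCentralizing

end VonNeumannAlgebra

/-! ### Vector states under the support, represented in the cyclic subspace -/

namespace VonNeumannAlgebra

open Amplified Filter

variable {H : Type*} [NormedAddCommGroup H] [InnerProductSpace ℂ H] [CompleteSpace H]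

variable {M D : VonNeumannAlgebra H} {ξ : Amplified H}

namespace IsCentralizing

/-- On the orbit, `⟪d₂ ξ, w d₁ ξ⟫ = ω (d₂* w d₁) = ω (d₁ d₂* w)` for `w ∈ M`, so testing against `D`
on one side suffices; density does the rest. -/
theorem inner_eq_of_mem_cyclicSpace (h : IsCentralizing M D ξ) (hDM : D ≤ M) {x y : H →L[ℂ] H}
    (hx : x ∈ M) (hy : y ∈ M)
    (hxy : ∀ d ∈ D, ⟪ξ, amplify H (d * y) ξ⟫_ℂ = ⟪ξ, amplify H (d * x) ξ⟫_ℂ)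
    {u v : Amplified H} (hu : u ∈ D.cyclicSpace ξ) (hv : v ∈ D.cyclicSpace ξ) :
    ⟪u, amplify H y v⟫_ℂ = ⟪u, amplify H x v⟫_ℂ := by
  refine cyclicSpace_induction (p := fun u => ⟪u, amplify H y v⟫_ℂ = ⟪u, amplify H x v⟫_ℂ)
    (isClosed_eq (by fun_prop) (by fun_prop)) (fun d₂ hd₂ => ?_) hu
  refine cyclicSpace_induction (p := fun v => ⟪_, amplify H y v⟫_ℂ = ⟪_, amplify H x v⟫_ℂ)
    (isClosed_eq (by fun_prop) (by fun_prop)) (fun d₁ hd₁ => ?_) hv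
  have key : ∀ w ∈ M, ⟪amplify H d₂ ξ, amplify H w (amplify H d₁ ξ)⟫_ℂ =
      ⟪ξ, amplify H (d₁ * star d₂ * w) ξ⟫_ℂ := by
    intro w hw
    rw [inner_amplify_left, ← amplify_mul_apply, ← amplify_mul_apply, mul_assoc d₁,
      h _ hd₁ _ (mul_mem (hDM (star_mem hd₂)) hw), mul_assoc]
  rw [key y hy, key x hx, hxy _ (mul_mem hd₁ (star_mem hd₂))]

/-- If `dₙ α → α₀` and `dₙ ξ → 0`, then `α₀ = 0`, for `α` in the range of the support
projection. -/
theorem eq_zero_of_tendsto (h : IsCentralizing M D ξ) (hDM : D ≤ M) {α α₀ : Amplified H}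
    (hα : amplify H (D.supportProj ξ) α = α) {d : ℕ → H →L[ℂ] H} (hd : ∀ n, d n ∈ D)
    (h₁ : Tendsto (fun n => amplify H (d n) α) atTop (𝓝 α₀))
    (h₂ : Tendsto (fun n => amplify H (d n) ξ) atTop (𝓝 0)) : α₀ = 0 := by
  have hfix : amplify H (D.supportProj ξ) α₀ = α₀ := by
    have h₃ : Tendsto (fun n => amplify H (D.supportProj ξ) (amplify H (d n) α)) atTop
        (𝓝 (amplify H (D.supportProj ξ) α₀)) :=
      ((amplify H (D.supportProj ξ)).continuous.tendsto _).comp h₁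
    refine tendsto_nhds_unique h₃ (h₁.congr fun n => ?_)
    rw [← amplify_mul_apply, h.supportProj_commute hDM (hd n), amplify_mul_apply, hα]
  have h₄ : Tendsto (fun n => ‖amplify H (star (d n)) ξ‖) atTop (𝓝 0) := by
    refine (tendsto_zero_iff_norm_tendsto_zero.1 h₂).congr fun n => ?_
    exact (h.norm_star_apply hDM (hd n)).symm
  have h₅ : Tendsto (fun n => amplify H (star (d n)) ξ) atTop (𝓝 0) :=
    tendsto_zero_iff_norm_tendsto_zero.2 h₄
  refine ext_coord fun k => ?_
  -- `⟪d n α k, c ξ⟫ = ⟪α k, c (d n)* ξ⟫` tends to `0`. Thus the support projection kills `α₀`,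
  -- which it also fixes.
  have horth : α₀ k ∈ (LinearMap.range (D.evalAt ξ))ᗮ := by
    rw [Submodule.mem_orthogonal']
    rintro _ ⟨c, rfl⟩
    change ⟪α₀ k, c.1 ξ⟫_ℂ = 0
    have h₆ : Tendsto (fun n => ⟪d n (α k), c.1 ξ⟫_ℂ) atTop (𝓝 ⟪α₀ k, c.1 ξ⟫_ℂ) :=
      (((coord k).continuous.tendsto _).comp h₁).inner tendsto_const_nhds
    have h₇ : Tendsto (fun n => ⟪α k, c.1 (amplify H (star (d n)) ξ)⟫_ℂ) atTop
        (𝓝 ⟪α k, c.1 0⟫_ℂ) :=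
      tendsto_const_nhds.inner ((c.1.continuous.tendsto _).comp h₅)
    rw [map_zero, inner_zero_right] at h₇
    refine tendsto_nhds_unique h₆ (h₇.congr fun n => ?_)
    rw [c.2 _ (star_mem (hd n)), ContinuousLinearMap.star_eq_adjoint,
      ContinuousLinearMap.adjoint_inner_right]
  rw [← Submodule.orthogonal_closure] at horth
  have h₈ : D.supportProj ξ (α₀ k) = 0 := (Submodule.starProjection_apply_eq_zero_iff _).2 horth
  have h₉ : D.supportProj ξ (α₀ k) = α₀ k := congrArg (fun v : Amplified H => v k) hfix
  rw [← h₉, h₈]; rfl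

/-- A vector state under the support projection, plus the given state, is the vector state of a
vector in the cyclic subspace. -/
theorem exists_mem_cyclicSpace (h : IsCentralizing M D ξ) (hDM : D ≤ M) {α : Amplified H}
    (hα : amplify H (D.supportProj ξ) α = α) :
    ∃ ζ ∈ D.cyclicSpace ξ, ∀ d ∈ D,
      ⟪ζ, amplify H d ζ⟫_ℂ = ⟪α, amplify H d α⟫_ℂ + ⟪ξ, amplify H d ξ⟫_ℂ := by
  -- The vector `χ = α ⊕ ξ` has the desired sum as its vector state; it remains to carry it
  -- isometrically and `D`-equivariantly into the cyclic space of `ξ`. This is done by the polar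
  -- decomposition `W a` of `oddPart ∘ Q`.
  obtain ⟨χ, hχ₀, hχ₁⟩ := exists_even_odd α ξ
  set Q := (D.cyclicSpace χ).starProjection with hQ
  have hQd : ∀ d ∈ D, ∀ v, Q (amplify H d v) = amplify H d (Q v) := fun d hd v =>
    starProjection_cyclicSpace_amplify χ hd v
  obtain ⟨a, ha, han, haa, hac⟩ := ((oddPart : Amplified H →L[ℂ] Amplified H) ∘L Q).exists_abs
  have hcomm : ∀ d ∈ D, ∀ v, a (amplify H d v) = amplify H d (a v) := by
    intro d hd v
    refine DFunLike.congr_fun (hac (amplify H d) (ContinuousLinearMap.commute_adjoint_comp_self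
      (b := amplify H d) ?_ ?_)).eq v
    · ext1 v
      exact (congrArg oddPart (hQd d hd v)).trans (oddPart_amplify d _)
    · rw [adjoint_amplify]
      ext1 v
      exact (congrArg oddPart (hQd _ (star_mem hd) v)).trans (oddPart_amplify _ _)
  obtain ⟨W, hW, -, -⟩ := LinearMap.exists_clm_of_norm_le a.toLinearMap
    ((oddPart : Amplified H →L[ℂ] Amplified H) ∘L Q).toLinearMap zero_le_one
    (fun v => by rw [one_mul]; exact (han v).ge)
  have hW' : ∀ v, W (a v) = oddPart (Q v) := hW
  -- Injectivity of `α ⊕ ξ ↦ ξ` on the cyclic space of `χ`, that is, closability of `d ξ ↦ d α`. It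
  -- puts `χ` in the closure of the range of `a`, where `W` is isometric.
  have hker : ∀ v, oddPart (Q v) = 0 → Q v = 0 := by
    intro v hv
    obtain ⟨d, hd, hlim⟩ := exists_seq_of_mem_cyclicSpace
      (Submodule.starProjection_apply_mem (D.cyclicSpace χ) v)
    have h₀ := ((evenPart (H := H)).continuous.tendsto _).comp hlim
    have h₁ := ((oddPart (H := H)).continuous.tendsto _).comp hlim
    have h₂ : evenPart (Q v) = 0 := by
      refine h.eq_zero_of_tendsto hDM hα hd ?_ ?_
      · rw [← hχ₀]; exact h₀
      · rw [← hχ₁, ← hv]; exact h₁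
    rw [← inner_self_eq_zero (𝕜 := ℂ), inner_eq_even_add_odd, h₂, hv, inner_zero_left, add_zero]
  have hχ : χ ∈ (LinearMap.range a.toLinearMap).topologicalClosure := by
    rw [← Submodule.orthogonal_orthogonal_eq_closure, Submodule.mem_orthogonal']
    intro v hv
    have h₁ : a v = 0 := by
      rw [← inner_self_eq_zero (𝕜 := ℂ), ← ContinuousLinearMap.adjoint_inner_right, haa]
      exact (Submodule.mem_orthogonal' _ _).1 hv _ ⟨a v, rfl⟩
    have h₂ : oddPart (Q v) = 0 := by rw [← hW', h₁, map_zero]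
    have h₃ : Q χ = χ := Submodule.starProjection_eq_self_iff.2 (self_mem_cyclicSpace D χ)
    rw [← h₃, hQ, Submodule.inner_starProjection_left_eq_right, ← hQ, hker v h₂, inner_zero_right]
  have hodd : ∀ v ∈ D.cyclicSpace χ, oddPart v ∈ D.cyclicSpace ξ := by
    intro v hv
    refine cyclicSpace_induction (p := fun v => oddPart v ∈ D.cyclicSpace ξ)
      ((Submodule.isClosed_topologicalClosure _).preimage (oddPart (H := H)).continuous) ?_ hv
    intro d hd
    rw [oddPart_amplify, hχ₁]
    exact amplify_mem_cyclicSpace ξ hd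
  refine ⟨W χ, ?_, fun d hd => ?_⟩
  · refine closure_minimal (t := {v | W v ∈ D.cyclicSpace ξ}) ?_
      ((Submodule.isClosed_topologicalClosure _).preimage W.continuous) hχ
    rintro _ ⟨v, rfl⟩
    change W (a v) ∈ D.cyclicSpace ξ
    rw [hW']
    exact hodd _ (Submodule.starProjection_apply_mem _ v)
  · have h₁ : ⟪W χ, amplify H d (W χ)⟫_ℂ = ⟪χ, amplify H d χ⟫_ℂ := by
      refine closure_minimal (t := {v | ⟪W v, amplify H d (W v)⟫_ℂ = ⟪v, amplify H d v⟫_ℂ}) ?_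
        (isClosed_eq (by fun_prop) (by fun_prop)) hχ
      rintro _ ⟨v, rfl⟩
      change ⟪W (a v), amplify H d (W (a v))⟫_ℂ = ⟪a v, amplify H d (a v)⟫_ℂ
      rw [hW', ← hcomm d hd, ha, ← oddPart_amplify, ← hQd d hd]
      rfl
    rw [h₁, inner_eq_even_add_odd, evenPart_amplify, oddPart_amplify, hχ₀, hχ₁]

end IsCentralizing

end VonNeumannAlgebra

/-! ### Characterization of the expectation, and complete positivity -/

theorem IsSelfAdjoint.exists_negPart {B : Type*} [NonUnitalCStarAlgebra B] [PartialOrder B]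
    [StarOrderedRing B] {a : B} (ha : IsSelfAdjoint a) :
    ∃ b : B, 0 ≤ b ∧ b * a = -(b * b) ∧ (b = 0 → 0 ≤ a) := by
  refine ⟨a⁻, CFC.negPart_nonneg a, ?_, (CFC.negPart_eq_zero_iff a ha).1⟩
  have h : a⁻ * (a⁺ - a⁻) = -(a⁻ * a⁻) := by rw [mul_sub, CFC.negPart_mul_posPart, zero_sub]
  rwa [CFC.posPart_sub_negPart a ha] at h

theorem exists_eq_star_mul_self_of_nonneg {B : Type*} [NonUnitalCStarAlgebra B] [PartialOrder B]
    [StarOrderedRing B] {a : B} (ha : 0 ≤ a) : ∃ b : B, a = star b * b :=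
  CStarAlgebra.nonneg_iff_eq_star_mul_self.1 ha

namespace VonNeumannAlgebra

open Amplified

variable {H : Type*} [NormedAddCommGroup H] [InnerProductSpace ℂ H] [CompleteSpace H]

/-- The vector functional of a vector of the amplification on all bounded operators. -/
noncomputable def vectorState (ξ : Amplified H) : (H →L[ℂ] H) →ₗ[ℂ] ℂ where
  toFun x := ⟪ξ, amplify H x ξ⟫_ℂ
  map_add' x y := by rw [map_add, add_apply, inner_add_right]
  map_smul' c x := by rw [map_smul, smul_apply, inner_smul_right]; rfl

theorem vectorState_apply (ξ : Amplified H) (x : H →L[ℂ] H) :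
    vectorState ξ x = ⟪ξ, amplify H x ξ⟫_ℂ := rfl

theorem vectorState_star_mul_self (ξ : Amplified H) (x : H →L[ℂ] H) :
    vectorState ξ (star x * x) = ((‖amplify H x ξ‖ ^ 2 : ℝ) : ℂ) := by
  rw [vectorState_apply, amplify_mul_apply, ← inner_amplify_left, inner_self_eq_norm_sq_to_K]
  push_cast
  rfl

theorem vectorState_star (ξ : Amplified H) (x : H →L[ℂ] H) :
    vectorState ξ (star x) = star (vectorState ξ x) := by
  rw [vectorState_apply, vectorState_apply, ← inner_amplify_left]
  exact (inner_conj_symm _ _).symm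

/-- `y` is the conditional expectation of `x` on the corner of `D` cut out by the support. -/
structure IsExpectation (D : VonNeumannAlgebra H) (ξ : Amplified H) (x y : H →L[ℂ] H) : Prop where
  mem : y ∈ D
  mul_supportProj : y * D.supportProj ξ = y
  vectorState_mul : ∀ d ∈ D, vectorState ξ (d * y) = vectorState ξ (d * x)

variable {M D : VonNeumannAlgebra H} {ξ : Amplified H} {x x' y y' : H →L[ℂ] H}

theorem eq_zero_of_vectorState (hy : y ∈ D) (hz : y * D.supportProj ξ = y)
    (h : vectorState ξ (star y * y) = 0) : y = 0 := by
  rw [vectorState_star_mul_self] at h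
  have h₁ : amplify H y ξ = 0 := by
    have : ‖amplify H y ξ‖ ^ 2 = 0 := by exact_mod_cast h
    exact norm_eq_zero.1 (pow_eq_zero_iff two_ne_zero |>.1 this)
  rw [← hz]
  exact (mul_supportProj_eq_zero_iff ξ hy).2 h₁

namespace IsExpectation

/-- The difference `w` is orthogonal to `D` in the sense `ω (d w) = 0`; taking `d = w*` and using
faithfulness of `ω` on the corner gives `w = 0`. -/
theorem unique (h : IsExpectation D ξ x y) (h' : IsExpectation D ξ x y') : y = y' := by
  rw [← sub_eq_zero]
  refine eq_zero_of_vectorState (sub_mem h.mem h'.mem)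
    (by rw [sub_mul, h.mul_supportProj, h'.mul_supportProj]) ?_
  have hm := star_mem (sub_mem h.mem h'.mem)
  rw [mul_sub, map_sub, h.vectorState_mul _ hm, h'.vectorState_mul _ hm, sub_self]

theorem add (h : IsExpectation D ξ x y) (h' : IsExpectation D ξ x' y') :
    IsExpectation D ξ (x + x') (y + y') where
  mem := add_mem h.mem h'.mem
  mul_supportProj := by rw [add_mul, h.mul_supportProj, h'.mul_supportProj]
  vectorState_mul d hd := by
    rw [mul_add, mul_add, map_add, map_add, h.vectorState_mul d hd, h'.vectorState_mul d hd]

theorem smul (c : ℂ) (h : IsExpectation D ξ x y) : IsExpectation D ξ (c • x) (c • y) where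
  mem := SMulMemClass.smul_mem c h.mem
  mul_supportProj := by rw [smul_mul_assoc, h.mul_supportProj]
  vectorState_mul d hd := by
    rw [mul_smul_comm, mul_smul_comm, map_smul, map_smul, h.vectorState_mul d hd]

theorem of_mem (hx : x ∈ D) (hz : x * D.supportProj ξ = x) : IsExpectation D ξ x x :=
  ⟨hx, hz, fun _ _ => rfl⟩

end IsExpectation

theorem IsCentralizing.vectorState_comm (h : IsCentralizing M D ξ) {d : H →L[ℂ] H} (hd : d ∈ D)
    (hx : x ∈ M) : vectorState ξ (d * x) = vectorState ξ (x * d) :=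
  h d hd x hx

namespace IsExpectation

theorem mul_left (he : IsExpectation D ξ x y) {a : H →L[ℂ] H} (ha : a ∈ D) :
    IsExpectation D ξ (a * x) (a * y) where
  mem := mul_mem ha he.mem
  mul_supportProj := by rw [mul_assoc, he.mul_supportProj]
  vectorState_mul d hd := by
    rw [← mul_assoc, ← mul_assoc, he.vectorState_mul _ (mul_mem hd ha)]

theorem mul_right (he : IsExpectation D ξ x y) (h : IsCentralizing M D ξ) (hDM : D ≤ M)
    (hx : x ∈ M) {a : H →L[ℂ] H} (ha : a ∈ D) : IsExpectation D ξ (x * a) (y * a) where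
  mem := mul_mem he.mem ha
  mul_supportProj := by
    rw [mul_assoc, ← h.supportProj_commute hDM ha, ← mul_assoc, he.mul_supportProj]
  vectorState_mul d hd := by
    rw [← mul_assoc, ← mul_assoc, ← h.vectorState_comm ha (mul_mem (hDM hd) (hDM he.mem)),
      ← h.vectorState_comm ha (mul_mem (hDM hd) hx), ← mul_assoc, ← mul_assoc,
      he.vectorState_mul _ (mul_mem ha hd)]

theorem star (he : IsExpectation D ξ x y) (h : IsCentralizing M D ξ) (hDM : D ≤ M)
    (hx : x ∈ M) : IsExpectation D ξ (star x) (star y) where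
  mem := star_mem he.mem
  mul_supportProj := by
    have h₁ := congrArg Star.star he.mul_supportProj
    rw [← h.supportProj_commute hDM he.mem, star_mul,
      (D.isStarProjection_supportProj ξ).2.star_eq] at h₁
    exact h₁
  vectorState_mul d hd := by
    have h₁ : ∀ w ∈ M, vectorState ξ (d * Star.star w) =
        Star.star (vectorState ξ (Star.star d * w)) := by
      intro w hw
      rw [h.vectorState_comm (star_mem hd) hw, ← vectorState_star, star_mul, star_star]
    rw [h₁ y (hDM he.mem), h₁ x hx, he.vectorState_mul _ (star_mem hd)]

end IsExpectation

/-- The conditional expectation onto the corner of `D` cut out by the support. -/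
theorem IsCentralizing.exists_expectationMap (h : IsCentralizing M D ξ) (hDM : D ≤ M) :
    ∃ E : M →ₗ[ℂ] D, (∀ x : M, IsExpectation D ξ x (E x : H →L[ℂ] H)) ∧
      ∀ x : M, ‖(E x : H →L[ℂ] H)‖ ≤ ‖(x : H →L[ℂ] H)‖ := by
  choose e he₁ he₂ he₃ he₄ using fun x : M => h.exists_expectation hDM x.2
  have he : ∀ x : M, IsExpectation D ξ x (e x) := fun x => ⟨he₁ x, he₂ x, he₄ x⟩
  exact ⟨{ toFun := fun x => ⟨e x, he₁ x⟩
           map_add' := fun x y => Subtype.ext ((he (x + y)).unique ((he x).add (he y)))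
           map_smul' := fun c x => Subtype.ext ((he (c • x)).unique ((he x).smul c)) },
    he, he₃⟩

/-- The inclusion of a von Neumann subalgebra. -/
def inclusion (hDM : D ≤ M) : D →⋆ₙₐ[ℂ] M where
  toFun d := ⟨d, hDM d.2⟩
  map_smul' _ _ := rfl
  map_zero' := rfl
  map_add' _ _ := rfl
  map_mul' _ _ := rfl
  map_star' _ := rfl

/-- The inclusion of a von Neumann algebra into the bounded operators. -/
def toOperator (M : VonNeumannAlgebra H) : M →⋆ₙₐ[ℂ] (H →L[ℂ] H) where
  toFun d := d
  map_smul' _ _ := rfl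
  map_zero' := rfl
  map_add' _ _ := rfl
  map_mul' _ _ := rfl
  map_star' _ := rfl

theorem vectorState_matrix_star_mul_self {n : Type*} [Fintype n] (ξ : Amplified H)
    (Z : CStarMatrix n n (H →L[ℂ] H)) (i : n) :
    vectorState ξ ((star Z * Z) i i) = ((∑ j, ‖amplify H (Z j i) ξ‖ ^ 2 : ℝ) : ℂ) := by
  rw [CStarMatrix.mul_apply, map_sum, Complex.ofReal_sum]
  exact Finset.sum_congr rfl fun j _ => vectorState_star_mul_self ξ (Z j i)

/-- The conditional expectation is completely positive. -/
theorem IsCentralizing.map_cstarMatrix_nonneg (h : IsCentralizing M D ξ) (hDM : D ≤ M)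
    {E : M →ₗ[ℂ] D} (hE : ∀ x : M, IsExpectation D ξ x (E x : H →L[ℂ] H))
    {n : Type*} [Fintype n] {x : CStarMatrix n n M} (hx : 0 ≤ x) : 0 ≤ x.map E := by
  set A : CStarMatrix n n D := x.map E with hA
  have hEstar : ∀ w : M, E (star w) = star (E w) := fun w =>
    Subtype.ext ((hE (star w)).unique ((hE w).star h hDM w.2))
  have hAsa : IsSelfAdjoint A := by
    refine CStarMatrix.ext fun i j => ?_
    change star (E (x j i)) = E (x i j)
    rw [← hEstar]
    congr 1
    exact congrArg (fun w : CStarMatrix n n M => w i j) (IsSelfAdjoint.of_nonneg hx).star_eq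
  -- `N` has entries in `D`, which is why `E` takes values in `D` here. From `N A = -N²` one gets `N
  -- A N = -N³`, and `N³ = Y* Y`.
  obtain ⟨N, hN₀, hNA, hN⟩ := hAsa.exists_negPart
  have hNsa : star N = N := (IsSelfAdjoint.of_nonneg hN₀).star_eq
  obtain ⟨X, hX⟩ := exists_eq_star_mul_self_of_nonneg hx
  obtain ⟨Y, hY⟩ := exists_eq_star_mul_self_of_nonneg (star_left_conjugate_nonneg hN₀ N)
  rw [hNsa] at hY
  let ιD := CStarMatrix.mapₙₐ (n := n) D.toOperator
  let ιM := CStarMatrix.mapₙₐ (n := n) M.toOperator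
  -- Entrywise, the right factor from `D` moves to the front by the centralizing property, and then
  -- the definition of the expectation applies.
  have h₁ : ∀ i, vectorState ξ ((ιD N * ιD A * ιD N) i i) =
      vectorState ξ ((ιD N * ιM x * ιD N) i i) := by
    intro i
    simp only [CStarMatrix.mul_apply, map_sum, Finset.sum_mul]
    refine Finset.sum_congr rfl fun l _ => Finset.sum_congr rfl fun k _ => ?_
    have := hE (x k l)
    change vectorState ξ ((N i k : H →L[ℂ] H) * (E (x k l) : H →L[ℂ] H) * (N l i : H →L[ℂ] H)) =
      vectorState ξ ((N i k : H →L[ℂ] H) * (x k l : H →L[ℂ] H) * (N l i : H →L[ℂ] H))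
    rw [← h.vectorState_comm (N l i).2 (mul_mem (hDM (N i k).2) (hDM this.mem)),
      ← h.vectorState_comm (N l i).2 (mul_mem (hDM (N i k).2) (x k l).2), ← mul_assoc, ← mul_assoc,
      this.vectorState_mul _ (mul_mem (N l i).2 (N i k).2)]
  -- The diagonal values of `-Y* Y` and of `(X N)* (X N)` under the state agree; one is nonpositive
  -- and the other nonnegative, so both vanish.
  have h₂ : ∀ j i, amplify H (Y j i : H →L[ℂ] H) ξ = 0 := by
    intro j i
    have h₃ : ιD N * ιM x * ιD N = star (ιM X * ιD N) * (ιM X * ιD N) := by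
      rw [star_mul, hX, map_mul, map_star, ← map_star ιD, hNsa]
      simp only [mul_assoc]
    have h₄ : ιD N * ιD A * ιD N = -(star (ιD Y) * ιD Y) := by
      rw [← map_mul, ← map_mul, hNA, neg_mul, hY, map_neg, map_mul, map_star]
    have h₅ := h₁ i
    have h₆ : (-(star (ιD Y) * ιD Y)) i i = -((star (ιD Y) * ιD Y) i i) := rfl
    rw [h₃, h₄, h₆, map_neg, vectorState_matrix_star_mul_self,
      vectorState_matrix_star_mul_self, ← Complex.ofReal_neg, Complex.ofReal_inj] at h₅
    have h₇ : 0 ≤ ∑ j, ‖amplify H ((ιM X * ιD N) j i) ξ‖ ^ 2 :=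
      Finset.sum_nonneg fun _ _ => by positivity
    have h₈ : ∑ j, ‖amplify H (ιD Y j i) ξ‖ ^ 2 = 0 :=
      le_antisymm (by linarith) (Finset.sum_nonneg fun _ _ => by positivity)
    have h₉ := (Finset.sum_eq_zero_iff_of_nonneg fun _ _ => by positivity).1 h₈ j
      (Finset.mem_univ j)
    exact norm_eq_zero.1 (pow_eq_zero_iff two_ne_zero |>.1 h₉)
  -- The entries of `Y` vanish on the support, and those of `A` lie under it. Hence `N³ A = 0`,
  -- which yields `N⁴ = 0` and `N = 0`.
  have h₃ : Y * A = 0 := by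
    refine CStarMatrix.ext fun i j => ?_
    rw [CStarMatrix.mul_apply]
    refine Finset.sum_eq_zero fun k _ => Subtype.ext ?_
    change (Y i k : H →L[ℂ] H) * (E (x k j) : H →L[ℂ] H) = 0
    have := hE (x k j)
    rw [← this.mul_supportProj, ← h.supportProj_commute hDM this.mem, ← mul_assoc,
      (mul_supportProj_eq_zero_iff ξ (Y i k).2).2 (h₂ i k), zero_mul]
  have h₄ : N * N * N * N = 0 := by
    have : N * N * N * A = 0 := by rw [hY, mul_assoc, h₃, mul_zero]
    rw [mul_assoc, hNA, mul_neg, neg_eq_zero] at this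
    simpa only [mul_assoc] using this
  have h₅ : N * N = 0 := by
    rw [← CStarRing.star_mul_self_eq_zero_iff, star_mul, hNsa, ← mul_assoc]
    exact h₄
  have h₆ : N = 0 := by
    rw [← CStarRing.star_mul_self_eq_zero_iff, hNsa]
    exact h₅
  exact hN h₆

end VonNeumannAlgebra

/-! ### Normality, range, support and uniqueness -/

namespace VonNeumannAlgebra

open Amplified

variable {H : Type*} [NormedAddCommGroup H] [InnerProductSpace ℂ H] [CompleteSpace H]
  {M D : VonNeumannAlgebra H} {ξ : Amplified H}

/-- A linear map is ultraweakly continuous as soon as it pulls back the vector functionals of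
single vectors to normal functionals. -/
theorem continuous_ultraweak_of_mem_span {E : M →ₗ[ℂ] M}
    (h : ∀ u, (M.vectorFunctional (u, u)).comp E ∈
      Submodule.span ℂ (Set.range M.vectorFunctional)) :
    Continuous[M.ultraweak, M.ultraweak] E := by
  have key : ∀ p, Continuous[M.ultraweak, inferInstance] ((M.vectorFunctional p).comp E) := by
    rintro ⟨u, v⟩
    rw [ultraweak_eq]
    refine (LinearMap.mem_span_iff_continuous _).1 ?_
    have h₁ : (M.vectorFunctional (u, v)).comp E = (1 / 4 : ℂ) •
        ((M.vectorFunctional (u + v, u + v)).comp E - (M.vectorFunctional (u - v, u - v)).comp E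
          + Complex.I • (M.vectorFunctional (u + Complex.I • v, u + Complex.I • v)).comp E
          - Complex.I • (M.vectorFunctional (u - Complex.I • v, u - Complex.I • v)).comp E) := by
      ext x
      have h₂ := inner_map_polarization
        (ContinuousLinearMap.adjoint (amplify H (E x : H →L[ℂ] H))).toLinearMap u v
      simp only [ContinuousLinearMap.coe_coe, ContinuousLinearMap.adjoint_inner_left] at h₂
      refine h₂.trans ?_
      change _ = (1 / 4 : ℂ) * (_ - _ + Complex.I * _ - Complex.I * _)
      rw [div_eq_inv_mul, one_div]
      rfl
    rw [h₁]
    refine Submodule.smul_mem _ _ (Submodule.sub_mem _ (Submodule.add_mem _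
      (Submodule.sub_mem _ (h _) (h _)) (Submodule.smul_mem _ _ (h _)))
      (Submodule.smul_mem _ _ (h _)))
  rw [continuous_iff_le_induced]
  conv_rhs => rw [ultraweak_eq]
  rw [induced_iInf]
  refine le_iInf fun p => ?_
  rw [induced_compose]
  exact continuous_iff_le_induced.1 (key p)

namespace IsCentralizing

/-- The conditional expectation is normal. -/
theorem continuous_ultraweak (h : IsCentralizing M D ξ) (hDM : D ≤ M)
    {E : M →ₗ[ℂ] M} (hE : ∀ x : M, IsExpectation D ξ x (E x : H →L[ℂ] H)) :
    Continuous[M.ultraweak, M.ultraweak] E := by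
  refine continuous_ultraweak_of_mem_span fun u => ?_
  have hz := D.isStarProjection_supportProj ξ
  set z := D.supportProj ξ with hzdef
  have hzz : star z = z := hz.2.star_eq
  set α := amplify H z u with hα
  have hαz : amplify H z α = α := by
    rw [hα, ← amplify_mul_apply, hz.1.eq]
  obtain ⟨ζ, hζ, hζα⟩ := h.exists_mem_cyclicSpace hDM hαz
  -- The values of `E` live under `z`, so `u` may be replaced by `α = z u`. Adding and subtracting
  -- the state of `ξ` moves everything to vectors of the cyclic space, where `E x` and `x` have the
  -- same coefficients.
  have h₁ : (M.vectorFunctional (u, u)).comp E =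
      M.vectorFunctional (ζ, ζ) - M.vectorFunctional (ξ, ξ) := by
    ext x
    change ⟪u, amplify H (E x : H →L[ℂ] H) u⟫_ℂ =
      ⟪ζ, amplify H (x : H →L[ℂ] H) ζ⟫_ℂ - ⟪ξ, amplify H (x : H →L[ℂ] H) ξ⟫_ℂ
    have h₂ : (E x : H →L[ℂ] H) = z * (E x : H →L[ℂ] H) * z := by
      rw [h.supportProj_commute hDM (hE x).mem, mul_assoc, hz.1.eq, (hE x).mul_supportProj]
    have h₃ : ⟪u, amplify H (E x : H →L[ℂ] H) u⟫_ℂ = ⟪α, amplify H (E x : H →L[ℂ] H) α⟫_ℂ := by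
      conv_lhs => rw [h₂, amplify_mul_apply, amplify_mul_apply, ← hzz, ← inner_amplify_left, hzz]
    have h₄ : ∀ w ∈ D.cyclicSpace ξ,
        ⟪w, amplify H (E x : H →L[ℂ] H) w⟫_ℂ = ⟪w, amplify H (x : H →L[ℂ] H) w⟫_ℂ := fun w hw =>
      h.inner_eq_of_mem_cyclicSpace hDM x.2 (E x).2 (hE x).vectorState_mul hw hw
    rw [h₃, ← h₄ ζ hζ, ← h₄ ξ (self_mem_cyclicSpace D ξ),
      hζα _ (hE x).mem, add_sub_cancel_right]
  rw [h₁]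
  exact Submodule.sub_mem _ (Submodule.subset_span ⟨_, rfl⟩) (Submodule.subset_span ⟨_, rfl⟩)

/-- The elements of the corner of `D` cut out by the support projection. -/
def corner (h : IsCentralizing M D ξ) (hDM : D ≤ M) : NonUnitalStarSubalgebra ℂ M where
  carrier := {y | (y : H →L[ℂ] H) ∈ D ∧ (y : H →L[ℂ] H) * D.supportProj ξ = y}
  add_mem' {a b} ha hb := ⟨add_mem ha.1 hb.1, by
    rw [AddMemClass.coe_add, add_mul, ha.2, hb.2]⟩
  zero_mem' := ⟨zero_mem D, zero_mul _⟩
  mul_mem' {a b} ha hb := ⟨mul_mem ha.1 hb.1, by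
    rw [MulMemClass.coe_mul, mul_assoc, hb.2]⟩
  smul_mem' c a ha := ⟨SMulMemClass.smul_mem c ha.1, by
    have : ((c • a : M) : H →L[ℂ] H) = c • (a : H →L[ℂ] H) := rfl
    rw [this, smul_mul_assoc, ha.2]⟩
  star_mem' {a} ha := by
    have := (IsExpectation.of_mem ha.1 ha.2).star h hDM a.2
    exact ⟨this.mem, this.mul_supportProj⟩

theorem range_eq_corner (h : IsCentralizing M D ξ) (hDM : D ≤ M)
    {E : M →ₗ[ℂ] M} (hE : ∀ x : M, IsExpectation D ξ x (E x : H →L[ℂ] H)) :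
    Set.range E = h.corner hDM := by
  ext y
  constructor
  · rintro ⟨x, rfl⟩
    exact ⟨(hE x).mem, (hE x).mul_supportProj⟩
  · rintro ⟨h₁, h₂⟩
    exact ⟨y, Subtype.ext ((hE y).unique (.of_mem h₁ h₂))⟩

/-- The conditional expectation has all the required properties. -/
theorem isPreservingModuleProjection (h : IsCentralizing M D ξ) (hDM : D ≤ M) {ω : M →ₗ[ℂ] ℂ}
    (hω : ∀ x : M, ω x = ⟪ξ, amplify H (x : H →L[ℂ] H) ξ⟫_ℂ)
    {E : M →ₗ[ℂ] M} (hE : ∀ x : M, IsExpectation D ξ x (E x : H →L[ℂ] H))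
    (hEn : ∀ x : M, ‖E x‖ ≤ ‖x‖) :
    IsPreservingModuleProjection D ω (⟨D.supportProj ξ, hDM (D.supportProj_mem ξ)⟩ : M) E where
  preserving x := by
    have := (hE x).vectorState_mul 1 (one_mem D)
    rw [one_mul, one_mul] at this
    rw [hω, hω]
    exact this
  normal := h.continuous_ultraweak hDM hE
  idempotent x :=
    Subtype.ext ((hE (E x)).unique (.of_mem (hE x).mem (hE x).mul_supportProj))
  contractive := hEn
  map_left d hd x := Subtype.ext ((hE (d * x)).unique ((hE x).mul_left hd))
  map_right d hd x := Subtype.ext ((hE (x * d)).unique ((hE x).mul_right h hDM x.2 hd))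
  range_starSubalgebra := ⟨h.corner hDM, fun _ hr => hr.1, h.range_eq_corner hDM hE⟩
  support_le := by
    have hD := isSupportProjection_supportProj hDM hω
    have hM := isSupportProjection_supportProj (le_refl M) hω
    -- Consequently the support of `E` is the support of `ω` on all of `M`, which is below the
    -- support on the smaller algebra `D`.
    have key : ∀ p : M, IsStarProjection p → (E p = 0 ↔ ω p = 0) := by
      intro p hp
      constructor
      · intro hp₀
        have := (hE p).vectorState_mul 1 (one_mem D)
        rw [one_mul, one_mul, hp₀] at this
        rw [hω]
        exact this.symm.trans (map_zero (vectorState ξ))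
      · intro hp₀
        have hp₁ : (p : H →L[ℂ] H) = star (p : H →L[ℂ] H) * p :=
          congrArg Subtype.val (hp.2.star_eq.symm ▸ hp.1.eq.symm : p = star p * p)
        have hp₂ : amplify H (p : H →L[ℂ] H) ξ = 0 := by
          rw [hω, hp₁, amplify_mul_apply, ← inner_amplify_left] at hp₀
          exact inner_self_eq_zero.1 hp₀
        refine Subtype.ext ((hE p).unique ⟨zero_mem D, zero_mul _, fun d _ => ?_⟩)
        rw [ZeroMemClass.coe_zero, mul_zero, map_zero, vectorState_apply, amplify_mul_apply, hp₂,
          map_zero, inner_zero_right]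
    refine ⟨⟨M.supportProj ξ, M.supportProj_mem ξ⟩, ⟨?_, ?_⟩, ?_⟩
    · exact ⟨hM.1.1, hM.1.2.1, (key _ hM.1.2.1).2 hM.1.2.2⟩
    · rintro p ⟨hp₁, hp₂, hp₃⟩
      exact hM.2 ⟨hp₁, hp₂, (key p hp₂).1 hp₃⟩
    · exact (sub_le_sub_iff_left _).1 (hM.2 ⟨hDM hD.1.1, hD.1.2⟩)

end IsCentralizing

/-- A preserving module projection is given by the conditional expectation. -/
theorem IsPreservingModuleProjection.isExpectation {ω : M →ₗ[ℂ] ℂ} (hDM : D ≤ M)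
    (hω : ∀ x : M, ω x = ⟪ξ, amplify H (x : H →L[ℂ] H) ξ⟫_ℂ) {F : M →ₗ[ℂ] M}
    (hF : IsPreservingModuleProjection D ω (⟨D.supportProj ξ, hDM (D.supportProj_mem ξ)⟩ : M) F)
    (x : M) : IsExpectation D ξ x (F x : H →L[ℂ] H) := by
  set z : M := ⟨D.supportProj ξ, hDM (D.supportProj_mem ξ)⟩ with hz
  have hD : IsSupportProjection D ω z := isSupportProjection_supportProj hDM hω
  have hmem : ∀ x : M, (F x : H →L[ℂ] H) ∈ D := by
    obtain ⟨R, hR, hFR⟩ := hF.range_starSubalgebra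
    intro x
    refine hR _ ?_
    rw [← SetLike.mem_coe, ← hFR]
    exact ⟨x, rfl⟩
  -- Since `s ≤ z`, `1 - z = (1 - s) (1 - z)`, and the module property pulls out the factor `1 - z ∈
  -- D`.
  have h₀ : F (1 - z) = 0 := by
    obtain ⟨s, hs, hsz⟩ := hF.support_le
    have h₁ : (1 - s) * (1 - z) = 1 - z :=
      (hD.1.2.1.le_iff_mul_eq_right hs.1.2.1).1 (sub_le_sub_left hsz 1)
    rw [← h₁, hF.map_right _ hD.1.1, hs.1.2.2, zero_mul]
  refine ⟨hmem x, ?_, fun d hd => ?_⟩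
  · have h₁ : F x * (1 - z) = 0 := by
      have h₂ := hF.map_left _ (hmem x) (1 - z)
      rwa [hF.map_right _ hD.1.1, hF.idempotent, h₀, mul_zero] at h₂
    rw [mul_sub, mul_one, sub_eq_zero] at h₁
    exact (congrArg Subtype.val h₁).symm
  · have h₁ := hF.preserving (⟨d, hDM hd⟩ * x)
    rw [hF.map_left _ hd, hω, hω] at h₁
    exact h₁

end VonNeumannAlgebra

/-! ### The main theorem -/

theorem theorem3p10 {H : Type*} [NormedAddCommGroup H] [InnerProductSpace ℂ H] [CompleteSpace H]
    (M D : VonNeumannAlgebra H) (hDM : D ≤ M)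
    (ω : M →ₗ[ℂ] ℂ) (hω : M.IsNormalState ω)
    (hcentral : ∀ a : M, (a : H →L[ℂ] H) ∈ D → ∀ x : M, ω (a * x) = ω (x * a)) :
    ∃ z : M, VonNeumannAlgebra.IsSupportProjection D ω z ∧
      ∃ E : M →ₗ[ℂ] M,
        VonNeumannAlgebra.IsPreservingModuleProjection D ω z E ∧
        (∃ Φ : M →CP M, Φ.toLinearMap = E) ∧
        Set.range E = {y : M | ∃ d : M, (d : H →L[ℂ] H) ∈ D ∧ y = z * d} ∧
        (∀ d y : M, (d : H →L[ℂ] H) ∈ D → y ∈ Set.range E →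
          d * y ∈ Set.range E ∧ y * d ∈ Set.range E) ∧
        ∀ F : M →ₗ[ℂ] M,
          VonNeumannAlgebra.IsPreservingModuleProjection D ω z F → F = E := by
  obtain ⟨ξ, hξ⟩ := hω.exists_vector
  have h : M.IsCentralizing D ξ := fun a ha x hx => by
    have := hcentral ⟨a, hDM ha⟩ ha ⟨x, hx⟩
    rwa [hξ, hξ] at this
  obtain ⟨E₀, hE₀, hEn⟩ := h.exists_expectationMap hDM
  let E : M →ₗ[ℂ] M := (VonNeumannAlgebra.inclusion hDM : D →ₗ[ℂ] M) ∘ₗ E₀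
  have hE : ∀ x : M, D.IsExpectation ξ x (E x : H →L[ℂ] H) := hE₀
  have hP := h.isPreservingModuleProjection hDM hξ hE hEn
  have hcomm : ∀ y ∈ D, D.supportProj ξ * y = y * D.supportProj ξ := fun y hy =>
    h.supportProj_commute hDM hy
  refine ⟨_, VonNeumannAlgebra.isSupportProjection_supportProj hDM hξ, E, hP,
    ⟨⟨E, fun k x hx => ?_⟩, rfl⟩, ?_, fun d y hd hy => ?_, fun F hF => ?_⟩
  · exact map_nonneg (CStarMatrix.mapₙₐ (VonNeumannAlgebra.inclusion hDM))
      (h.map_cstarMatrix_nonneg hDM hE₀ hx)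
  · rw [h.range_eq_corner hDM hE]
    ext y
    constructor
    · rintro ⟨hy, hyz⟩
      exact ⟨y, hy, Subtype.ext (hyz.symm.trans (hcomm _ hy).symm)⟩
    · rintro ⟨d, hd, rfl⟩
      refine ⟨mul_mem (D.supportProj_mem ξ) hd, ?_⟩
      change D.supportProj ξ * (d : H →L[ℂ] H) * D.supportProj ξ = D.supportProj ξ * d
      rw [hcomm _ hd, mul_assoc, (D.isStarProjection_supportProj ξ).1.eq]
  · obtain ⟨x, rfl⟩ := hy
    exact ⟨⟨d * x, hP.map_left d hd x⟩, ⟨x * d, hP.map_right d hd x⟩⟩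
  · exact LinearMap.ext fun x => Subtype.ext ((hF.isExpectation hDM hξ x).unique (hE x))
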